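/- Fix a field $K$, an integer $m\ge 1$, real numbers $0=a_0<a_1<\dots<a_{m-1}<a_m=2\pi$, and for each $p\in\{0,\dots,m-1\}$ a strictly increasing sequence $(z_{p,k})_{k\in\mathbb Z}$ in $(a_p,a_{p+1})$ with $z_{p,k}\to a_p$ as $k\to-\infty$ and $z_{p,k}\to a_{p+1}$ as $k\to+\infty$. Let $\mathcal Z_m=\{z_{p,k}\}\subset(0,2\pi)$ (also regarded as a subset of $S^1=\mathbb R/2\pi\mathbb Z$); $a_0,\dots,a_{m-1}$ are its accumulation points in $S^1$, and for $z=z_{p,k}$ write $z^+=z_{p,k+1}$. Define the $2\pi$-periodic function $\kappa:\mathbb R\to\mathbb R_{>0}$ by $\kappa(s)=2\pi+z^+-s$ if $s\in[z,z^+)$ for some $z\in\mathcal Z_m$, and $\kappa(a_p)=2\pi$ for $0\le p<m$. Regard $S^1$ as a category whose morphisms are the anticlockwise paths: for $x,y\in S^1$ the morphisms $x\to y$ are $g_{xy}\omega_x^n$, $n\ge 0$, where $g_{xy}$ is the shortest anticlockwise path from $x$ to $y$ (the constant path if $x=y$), $\omega_x$ is one full anticlockwise turn at $x$, and composition is concatenation.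 A representation of $S^1$ is a functor $M$ from $S^1$ to $K$-vector spaces; it is pointwise finite if every $M(x)$ is finite dimensional. For a bounded interval $U\subset\mathbb R$, the string $\overline M_U$ is the representation for which $\overline M_U(x)$ has as basis the points of $U$ lying over $x$, and a path of length $d$ sends a basis element $b$ to $b+d$ if $b+d\in U$ and to $0$ otherwise. Let $\mathrm{Rep}^{\mathrm{pwf}}(S^1,\kappa)$ be the full subcategory of those pointwise finite representations each of whose indecomposable direct summands is isomorphic to $\overline M_U$ for some bounded interval $U\subseteq[\inf U,\inf U+\kappa(\inf U)]$. Let $\mathrm{rep}(\mathcal Z_m,\kappa)$ be its full subcategory of those $M$ such that (1) $M(g_{xy})$ is an isomorphism whenever $z<x\le y\le z^+$ for some $z\in\mathcal Z_m$; and (2) for each accumulation point $p$ there are $a,b\in\mathcal Z_m$ with $a<p<b$ in cyclic order such that $M(g_{xy})$ is an isomorphism whenever $a<x\le y\le b$ in cyclic order. Let $$\mathcal I=\{(u_1,u_2+2h\pi]\subset\mathbb R : u_1,u_2\in\mathcal Z_m,\ h\in\mathbb Z,\ u_1^+\le u_2+2h\pi\le u_1^++2\pi\}.$$ **Theorem.**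 The category $\mathrm{rep}(\mathcal Z_m,\kappa)$ is Krull–Schmidt, i.e. it is additive and each of its objects is a finite direct sum of objects with local endomorphism rings; moreover each object has, up to isomorphism, only finitely many indecomposable direct summands. For every $U\in\mathcal I$ the string $\overline M_U$ lies in $\mathrm{rep}(\mathcal Z_m,\kappa)$, and the indecomposable objects of $\mathrm{rep}(\mathcal Z_m,\kappa)$ are, up to isomorphism, exactly the strings $\overline M_U$ with $U\in\mathcal I$. -/

import Mathlib

open CategoryTheory CategoryTheory.Limits

universe u v w

noncomputable section

namespace InfiniteNakayama

/-! ### Generalities on additive categories -/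

section Additive

variable {C : Type u} [Category.{v} C] [HasZeroMorphisms C]

/-- `X ≅ Y ⊕ Z`. -/
def IsDirectSum (X Y Z : C) : Prop :=
  ∃ b : BinaryBicone Y Z, Nonempty b.IsBilimit ∧ Nonempty (X ≅ b.pt)

/-- `Y` is (isomorphic to) a direct summand of `X`. -/
def IsDirectSummand (Y X : C) : Prop :=
  ∃ Z : C, IsDirectSum X Y Z

/-- `X` is nonzero and in every decomposition `X ≅ Y ⊕ Z` one of the summands is zero.
Unlike Mathlib's `Indecomposable`, this makes sense before one knows that the
category has all binary biproducts; see `isIndecomposable_iff`. -/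
def IsIndecomposable (X : C) : Prop :=
  ¬ IsZero X ∧ ∀ Y Z : C, IsDirectSum X Y Z → IsZero Y ∨ IsZero Z

theorem isIndecomposable_iff [HasBinaryBiproducts C] (X : C) :
    IsIndecomposable X ↔ Indecomposable X := by
  refine and_congr Iff.rfl ⟨fun h Y Z e => ?_, fun h Y Z => ?_⟩
  · exact h Y Z ⟨BinaryBiproduct.bicone Y Z, ⟨BinaryBiproduct.isBilimit Y Z⟩, ⟨e⟩⟩
  · rintro ⟨b, ⟨hb⟩, ⟨e⟩⟩
    exact h Y Z (e ≪≫ biprod.uniqueUpToIso Y Z hb)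

end Additive

/-- A Krull–Schmidt category: an additive category in which every object is a finite direct
sum of objects with local endomorphism rings. -/
class IsKrullSchmidt (C : Type u) [Category.{v} C] [Preadditive C] : Prop
    extends HasFiniteBiproducts C where
  exists_decomposition (X : C) : ∃ (n : ℕ) (f : Fin n → C),
    (∀ i, IsLocalRing (End (f i))) ∧ Nonempty (X ≅ ⨁ f)

/-! ### The circle as a category, and its representations -/

/-- The circle `ℝ / 2πℤ`. -/
@[ext]
structure S1 : Type where
  point : AddCircle (2 * Real.pi)

/-- The covering map `ℝ → S¹`. -/
def cov (t : ℝ) : S1 := ⟨(t : AddCircle (2 * Real.pi))⟩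

/-- Rotation of a point of the circle anticlockwise by the angle `d`. -/
def S1.rotate (x : S1) (d : ℝ) : S1 :=
  ⟨x.point + (d : AddCircle (2 * Real.pi))⟩

/-- Anticlockwise paths from `x` to `y`; such a path is determined by its length. If `x ≠ y`,
the path `g_{xy}` is the one of length in `(0, 2π)`, `g_{xx}` is the one of length `0`,
the full turn `ω_x` is the one of length `2π`, and the paths `x → y` are precisely the
`g_{xy} ω_x ^ n` with `n = 0, 1, 2, …`. -/
@[ext]
structure S1.Path (x y : S1) : Type where
  length : ℝ
  nonneg : 0 ≤ length
  rotate_eq : x.rotate length = y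

theorem S1.rotate_zero (x : S1) : x.rotate 0 = x := by
  simp [S1.rotate]

theorem S1.rotate_rotate (x : S1) (d e : ℝ) : (x.rotate d).rotate e = x.rotate (d + e) := by
  simp [S1.rotate, add_assoc]

theorem cov_rotate (t d : ℝ) : (cov t).rotate d = cov (t + d) := by
  simp [S1.rotate, cov]

/-- The circle as a category: objects are points, morphisms are anticlockwise paths,
composition is concatenation. -/
instance : SmallCategory S1 where
  Hom x y := S1.Path x y
  id x := ⟨0, le_rfl, x.rotate_zero⟩
  comp f g := ⟨f.length + g.length, add_nonneg f.nonneg g.nonneg, by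
    rw [← S1.rotate_rotate, f.rotate_eq, g.rotate_eq]⟩
  id_comp f := S1.Path.ext (zero_add _)
  comp_id f := S1.Path.ext (add_zero _)
  assoc f g h := S1.Path.ext (add_assoc _ _ _)

/-- The image in `S¹` of the path from `s` to `t` in `ℝ`; if `t - s < 2π`, this is the path
`g_{xy}` from `x = cov s` to `y = cov t`. -/
def pathOfLE {s t : ℝ} (h : s ≤ t) : cov s ⟶ cov t :=
  (⟨t - s, sub_nonneg.2 h, by rw [cov_rotate, add_sub_cancel]⟩ : S1.Path (cov s) (cov t))

/-- Representations of `S¹` over `K`: covariant functors to `K`-vector spaces. -/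
abbrev RepS1 (K : Type w) [Field K] := S1 ⥤ ModuleCat.{w} K

/-- A representation is pointwise finite if all its values are finite-dimensional. -/
def IsPointwiseFinite {K : Type w} [Field K] (M : RepS1 K) : Prop :=
  ∀ x : S1, FiniteDimensional K (M.obj x)

/-! ### Strings -/

/-- A bounded interval of the real line (open, closed, half-open, a point or empty). -/
structure BoundedInterval where
  carrier : Set ℝ
  ordConnected : carrier.OrdConnected
  bddBelow : BddBelow carrier
  bddAbove : BddAbove carrier

/-- The bounded interval `(a, b]`. -/
def BoundedInterval.Ioc (a b : ℝ) : BoundedInterval :=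
  ⟨Set.Ioc a b, Set.ordConnected_Ioc, bddBelow_Ioc, bddAbove_Ioc⟩

/-- The points `b_{1,x} < … < b_{n,x}` of the interval `U` lying over `x`. -/
@[ext]
structure BoundedInterval.Fiber (U : BoundedInterval) (x : S1) : Type where
  val : ℝ
  mem : val ∈ U.carrier
  cov_eq : cov val = x

open Classical in
/-- The image of the basis vector `b` under the path `f : x ⟶ y` in the string of `U`: it is
`b + length f` if this point is in `U`, and `0` otherwise. -/
def stringStep (K : Type w) [Field K] (U : BoundedInterval) {x y : S1} (f : S1.Path x y)
    (b : U.Fiber x) : U.Fiber y →₀ K :=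
  if h : b.val + f.length ∈ U.carrier then
    Finsupp.single ⟨b.val + f.length, h, by rw [← cov_rotate, b.cov_eq, f.rotate_eq]⟩ 1
  else 0

theorem stringStep_id (K : Type w) [Field K] (U : BoundedInterval) (x : S1) (b : U.Fiber x) :
    stringStep K U (⟨0, le_rfl, x.rotate_zero⟩ : S1.Path x x) b = Finsupp.single b 1 := by
  have h : b.val + (0 : ℝ) ∈ U.carrier := by simpa using b.mem
  rw [stringStep, dif_pos h]
  congr 1
  exact BoundedInterval.Fiber.ext (add_zero _)

theorem stringStep_comp (K : Type w) [Field K] (U : BoundedInterval) {x y z : S1}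
    (f : S1.Path x y) (g : S1.Path y z) (fg : S1.Path x z)
    (hfg : fg.length = f.length + g.length) (b : U.Fiber x) :
    stringStep K U fg b =
      Finsupp.linearCombination K (stringStep K U g) (stringStep K U f b) := by
  by_cases h : b.val + f.length ∈ U.carrier
  · rw [stringStep.eq_1 K U f, dif_pos h, Finsupp.linearCombination_single, one_smul]
    have e : b.val + fg.length = b.val + f.length + g.length := by rw [hfg, add_assoc]
    by_cases h2 : b.val + f.length + g.length ∈ U.carrier
    · rw [stringStep, dif_pos (e ▸ h2), stringStep, dif_pos h2]
      congr 1
      exact BoundedInterval.Fiber.ext e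
    · rw [stringStep, dif_neg (e ▸ h2), stringStep, dif_neg h2]
  · have h' : b.val + fg.length ∉ U.carrier := fun hc =>
      h (U.ordConnected.out b.mem hc
        ⟨by linarith [f.nonneg], by rw [hfg]; linarith [g.nonneg]⟩)
    rw [stringStep, dif_neg h', stringStep, dif_neg h, map_zero]

/-- The string of the bounded interval `U`: the space at `x` has the points of `U` over `x`
as a basis. -/
def stringRep (K : Type w) [Field K] (U : BoundedInterval) : RepS1 K where
  obj x := ModuleCat.of K (U.Fiber x →₀ K)
  map f := ModuleCat.ofHom (Finsupp.linearCombination K (stringStep K U f))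
  map_id x := by
    ext1
    refine Finsupp.lhom_ext' fun b => LinearMap.ext_ring ?_
    simp only [ModuleCat.hom_ofHom, LinearMap.comp_apply, Finsupp.lsingle_apply,
      Finsupp.linearCombination_single, one_smul]
    exact stringStep_id K U x b
  map_comp {x y z} f g := by
    ext1
    refine Finsupp.lhom_ext' fun b => LinearMap.ext_ring ?_
    simp only [ModuleCat.hom_ofHom, ModuleCat.hom_comp, LinearMap.comp_apply,
      Finsupp.lsingle_apply, Finsupp.linearCombination_single, one_smul]
    exact stringStep_comp K U f g (f ≫ g) rfl b

/-! ### Continuous Nakayama representations -/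

/-- The continuous Nakayama representations of `(S¹, κ)`: pointwise finite representations each
of whose indecomposable direct summands is the string of a bounded interval `U` with
`U ⊆ [inf U, inf U + κ (inf U)]`. -/
def IsContinuousNakayama {K : Type w} [Field K] (κ : ℝ → ℝ) (M : RepS1 K) : Prop :=
  IsPointwiseFinite M ∧
    ∀ N : RepS1 K, IsIndecomposable N → IsDirectSummand N M →
      ∃ U : BoundedInterval,
        U.carrier ⊆ Set.Icc (sInf U.carrier) (sInf U.carrier + κ (sInf U.carrier)) ∧
          Nonempty (N ≅ stringRep K U)

/-! ### The ∞-gon -/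

/-- An `∞`-gon with `m` two-sided accumulation points: `m` copies of `ℤ` embedded in
`(0, 2π)`. The `m` accumulation points, seen in `[0, 2π)`, are
`0 = acc 0 < acc 1 < ⋯ < acc (m - 1)`, and by convention `acc m = 2π`. The point number `k` of
the copy number `p` is `pt p k`; it lies between `acc p` and `acc (p + 1)`, and these are the
limits of the copy number `p`. In the cyclic order of the `∞`-gon
the successor of `pt p k` is `pt p (k + 1)`. -/
structure InfinityGon (m : ℕ) where
  acc : Fin (m + 1) → ℝ
  acc_strictMono : StrictMono acc
  acc_zero : acc 0 = 0
  acc_last : acc (Fin.last m) = 2 * Real.pi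
  pt : Fin m → ℤ → ℝ
  pt_strictMono : ∀ p, StrictMono (pt p)
  tendsto_atBot : ∀ p, Filter.Tendsto (pt p) Filter.atBot (nhds (acc p.castSucc))
  tendsto_atTop : ∀ p, Filter.Tendsto (pt p) Filter.atTop (nhds (acc p.succ))

variable {m : ℕ}

/-- The preimage in `ℝ` of the `∞`-gon as a subset of `S¹`. -/
def InfinityGon.preimage (Z : InfinityGon m) : Set ℝ :=
  {t | ∃ (p : Fin m) (k n : ℤ), t = Z.pt p k + 2 * n * Real.pi}

open Classical in
/-- The Kupisch function of the `∞`-gon: if `t ≡ s` mod `2π` with `s ∈ [0, 2π)`, then its value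
at `t` is `2π + z⁺ - s` if `s ∈ [z, z⁺)` for some (necessarily unique) point `z`, and `2π` if
there is no such `z`, that is, if `s` is an accumulation point. -/
def InfinityGon.kupisch (Z : InfinityGon m) (t : ℝ) : ℝ :=
  let s := toIcoMod Real.two_pi_pos 0 t
  if h : ∃ q : Fin m × ℤ, s ∈ Set.Ico (Z.pt q.1 q.2) (Z.pt q.1 (q.2 + 1)) then
    2 * Real.pi + Z.pt h.choose.1 (h.choose.2 + 1) - s
  else 2 * Real.pi

/-! ### Infinite discrete symmetric Nakayama representations -/

/-- `M(g_{xy})` is an isomorphism whenever `z < x ≤ y ≤ z⁺` for some point `z` of the `∞`-gon. -/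
def InfinityGon.IsConstantBetween (Z : InfinityGon m) {K : Type w} [Field K]
    (M : RepS1 K) : Prop :=
  ∀ (p : Fin m) (k : ℤ) (s t : ℝ) (_ : Z.pt p k < s) (hst : s ≤ t) (_ : t ≤ Z.pt p (k + 1)),
    IsIso (M.map (pathOfLE hst))

/-- For every accumulation point `p` there are points `a`, `b` of the `∞`-gon with `a < p < b`
in cyclic order such that `M(g_{xy})` is an isomorphism whenever `a < x ≤ y ≤ b` in cyclic
order. (The points are lifted to `ℝ`, with `b < a + 2π`.) -/
def InfinityGon.IsConstantNear (Z : InfinityGon m) {K : Type w} [Field K]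
    (M : RepS1 K) : Prop :=
  ∀ p : Fin m, ∃ a ∈ Z.preimage, ∃ b ∈ Z.preimage,
    a < Z.acc p.castSucc ∧ Z.acc p.castSucc < b ∧ b < a + 2 * Real.pi ∧
      ∀ (s t : ℝ) (_ : a < s) (hst : s ≤ t) (_ : t ≤ b), IsIso (M.map (pathOfLE hst))

/-- The infinite discrete symmetric Nakayama representations, as a property of
representations of `S¹`. -/
def InfinityGon.isNakayama (Z : InfinityGon m) (K : Type w) [Field K] :
    ObjectProperty (RepS1 K) := fun M =>
  IsContinuousNakayama Z.kupisch M ∧ Z.IsConstantBetween M ∧ Z.IsConstantNear M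

/-- The category of infinite discrete symmetric Nakayama representations, a full subcategory
of the category of representations of `S¹`. -/
abbrev InfinityGon.Rep (Z : InfinityGon m) (K : Type w) [Field K] :=
  (Z.isNakayama K).FullSubcategory

/-- The intervals `(u₁, u₂ + 2hπ]` with `u₁`, `u₂` points of the `∞`-gon, `h ∈ ℤ` and
`u₁⁺ ≤ u₂ + 2hπ ≤ u₁⁺ + 2π`. -/
def InfinityGon.intervals (Z : InfinityGon m) : Set BoundedInterval :=
  {U | ∃ (p q : Fin m) (k l h : ℤ),
    U = BoundedInterval.Ioc (Z.pt p k) (Z.pt q l + 2 * h * Real.pi) ∧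
      Z.pt p (k + 1) ≤ Z.pt q l + 2 * h * Real.pi ∧
      Z.pt q l + 2 * h * Real.pi ≤ Z.pt p (k + 1) + 2 * Real.pi}

end InfiniteNakayama

end

/-!
The category consists of representations of the circle that are determined by finitely many of
their values, and this finiteness replaces the structure theory of Nakayama representations.

Call a representation constant on `(c, d]` if it sends the paths inside `(c, d]` to isomorphisms.
The two constancy conditions say that every real number is an interior point of, or lies at the
junction of, intervals of constancy (`exists_isConstantOn_left`, `exists_isConstantOn_right`), so by
compactness finitely many such intervals cover the circle. Hence there is a finite set `T` of
points such that every value of the representation is identified with a value at a point of `T` by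
a structure map (`exists_isSampledBy`). Induction on the sum of the dimensions over `T` decomposes
the representation into finitely many indecomposables (`IsSampledBy.exists_isDecomposition`). An
endomorphism is determined by its components at `T`, so endomorphism algebras are
finite-dimensional, and an indecomposable one has a local endomorphism ring by Fitting's lemma
(`IsSampledBy.isLocalRing_end`).

By definition of a continuous Nakayama representation, the indecomposable summands are strings of
bounded intervals `U`. A path acts invertibly on such a string exactly if no lift of it enters or
leaves `U` (`isIso_stringRep_map_iff`). Constancy therefore forces `U = (a, b]` with `a` and `b`
over the ∞-gon (`exists_eq_Ioc`), and the Kupisch function, whose value at a point `z` is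
`2π + z⁺ - z`, gives the bound on the length that defines `Z.intervals`, after a translation by a
multiple of `2π` (`exists_mem_intervals_iso`).

Conversely the string of `(a, b]` has a local endomorphism ring, because its socle is spanned by the
basis vector at `b`, is contained in every nonzero subrepresentation and is preserved by
endomorphisms, so that an endomorphism not vanishing on the socle is injective
(`isLocalRing_end_stringRep_Ioc`). In particular it is indecomposable, hence its own only
indecomposable summand, and lies in the category.

It remains to see that the category is additive. It is closed under direct sums by the uniqueness
half of the Krull–Schmidt theorem (`IsDecomposition.exists_iso_of_retract`): an indecomposable
summand of a finite direct sum of strings has a local endomorphism ring, and is therefore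
isomorphic to one of the strings. It is closed under direct summands in the category of all
representations, so direct sums and indecomposability mean the same in both
(`isIndecomposable_obj_iff`).
-/

noncomputable section

namespace InfiniteNakayama

/-! ### Direct summands in preadditive categories -/

section Preadditive

variable {C : Type u} [Category.{v} C] [Preadditive C]

/-- In a decomposition of the identity the two summands are automatically orthogonal. -/
theorem comp_eq_zero_of_total {X Y Z : C} {i : Y ⟶ X} {p : X ⟶ Y} {j : Z ⟶ X} {q : X ⟶ Z}
    (h1 : i ≫ p = 𝟙 Y) (h2 : j ≫ q = 𝟙 Z) (h3 : p ≫ i + q ≫ j = 𝟙 X) : i ≫ q = 0 := by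
  have h : i ≫ (p ≫ i + q ≫ j) ≫ q = i ≫ q := by rw [h3, Category.id_comp]
  simpa [h2, reassoc_of% h1] using h

/-- Direct sums in terms of equations between morphisms: `i`, `j` are the inclusions and `p`, `q`
the projections. -/
theorem isDirectSum_iff {X Y Z : C} :
    IsDirectSum X Y Z ↔ ∃ (i : Y ⟶ X) (p : X ⟶ Y) (j : Z ⟶ X) (q : X ⟶ Z),
      i ≫ p = 𝟙 Y ∧ j ≫ q = 𝟙 Z ∧ p ≫ i + q ≫ j = 𝟙 X := by
  constructor
  · rintro ⟨b, ⟨hb⟩, ⟨e⟩⟩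
    refine ⟨b.inl ≫ e.inv, e.hom ≫ b.fst, b.inr ≫ e.inv, e.hom ≫ b.snd, by simp, by simp, ?_⟩
    have := IsBilimit.binary_total hb
    calc _ = e.hom ≫ (b.fst ≫ b.inl + b.snd ≫ b.inr) ≫ e.inv := by simp
      _ = _ := by rw [this]; simp
  · rintro ⟨i, p, j, q, h1, h2, h3⟩
    have hiq : i ≫ q = 0 := comp_eq_zero_of_total h1 h2 h3
    have hjp : j ≫ p = 0 := comp_eq_zero_of_total h2 h1 (by rw [add_comm, h3])
    let b : BinaryBicone Y Z :=
      { pt := X, fst := p, snd := q, inl := i, inr := j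
        inl_fst := h1, inl_snd := hiq, inr_fst := hjp, inr_snd := h2 }
    exact ⟨b, ⟨isBinaryBilimitOfTotal b h3⟩, ⟨Iso.refl _⟩⟩

theorem IsDirectSum.symm {X Y Z : C} (h : IsDirectSum X Y Z) : IsDirectSum X Z Y := by
  obtain ⟨i, p, j, q, h1, h2, h3⟩ := isDirectSum_iff.1 h
  exact isDirectSum_iff.2 ⟨j, q, i, p, h2, h1, by rw [add_comm, h3]⟩

theorem IsDirectSum.isDirectSummand {X Y Z : C} (h : IsDirectSum X Y Z) :
    IsDirectSummand Y X := ⟨Z, h⟩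

theorem IsDirectSummand.exists_retract {X Y : C} (h : IsDirectSummand Y X) :
    ∃ (i : Y ⟶ X) (p : X ⟶ Y), i ≫ p = 𝟙 Y := by
  obtain ⟨Z, h⟩ := h
  obtain ⟨i, p, -, -, h1, -⟩ := isDirectSum_iff.1 h
  exact ⟨i, p, h1⟩

/-- Over an idempotent complete category every retract is a direct summand: the complementary
idempotent provides a complement. -/
theorem isDirectSummand_of_retract [IsIdempotentComplete C] {X Y : C} {i : Y ⟶ X} {p : X ⟶ Y}
    (h : i ≫ p = 𝟙 Y) : IsDirectSummand Y X := by
  obtain ⟨Z, j, q, h2, h3⟩ := IsIdempotentComplete.idempotents_split X (𝟙 X - p ≫ i)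
    (by simp [reassoc_of% h])
  exact ⟨Z, isDirectSum_iff.2 ⟨i, p, j, q, h, h2, by rw [h3]; abel⟩⟩

theorem IsDirectSummand.trans [IsIdempotentComplete C] {X Y Z : C}
    (h : IsDirectSummand X Y) (h' : IsDirectSummand Y Z) : IsDirectSummand X Z := by
  obtain ⟨i, p, h1⟩ := h.exists_retract
  obtain ⟨j, q, h2⟩ := h'.exists_retract
  exact isDirectSummand_of_retract (i := i ≫ j) (p := q ≫ p) (by simp [reassoc_of% h2, h1])

theorem IsDirectSum.of_iso {X X' Y Z : C} (h : IsDirectSum X Y Z) (e : X' ≅ X) :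
    IsDirectSum X' Y Z := by
  obtain ⟨b, hb, ⟨e'⟩⟩ := h
  exact ⟨b, hb, ⟨e ≪≫ e'⟩⟩

theorem IsIndecomposable.of_iso {X Y : C} (h : IsIndecomposable X) (e : X ≅ Y) :
    IsIndecomposable Y :=
  ⟨fun hY => h.1 (hY.of_iso e), fun A B hAB => h.2 A B (hAB.of_iso e)⟩

theorem nontrivial_end {X : C} (h : ¬ IsZero X) : Nontrivial (End X) :=
  ⟨𝟙 X, 0, fun h' => h ((IsZero.iff_id_eq_zero X).2 h')⟩

theorem IsIndecomposable.eq_zero_or_eq_id [IsIdempotentComplete C] {X : C}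
    (hX : IsIndecomposable X) (e : X ⟶ X) (he : e ≫ e = e) : e = 0 ∨ e = 𝟙 X := by
  obtain ⟨Y, i, p, h1, h2⟩ := IsIdempotentComplete.idempotents_split X e he
  obtain ⟨Z, j, q, h3, h4⟩ := IsIdempotentComplete.idempotents_split X (𝟙 X - e) (by simp [he])
  rcases hX.2 Y Z (isDirectSum_iff.2 ⟨i, p, j, q, h1, h3, by rw [h2, h4]; abel⟩) with h | h
  · left; rw [← h2, h.eq_of_tgt p 0, zero_comp]
  · right
    have : 𝟙 X - e = 0 := by rw [← h4, h.eq_of_tgt q 0, zero_comp]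
    exact (sub_eq_zero.1 this).symm

/-- An indecomposable object has no nonzero retracts besides itself. -/
theorem IsIndecomposable.nonempty_iso_of_retract [IsIdempotentComplete C] {X Y : C}
    (hX : IsIndecomposable X) (hY : ¬ IsZero Y) {i : Y ⟶ X} {p : X ⟶ Y} (h : i ≫ p = 𝟙 Y) :
    Nonempty (Y ≅ X) := by
  rcases hX.eq_zero_or_eq_id (p ≫ i) (by simp [reassoc_of% h]) with h' | h'
  · refine absurd ((IsZero.iff_id_eq_zero Y).2 ?_) hY
    calc 𝟙 Y = i ≫ (p ≫ i) ≫ p := by simp [h]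
      _ = 0 := by rw [h']; simp
  · exact ⟨⟨i, p, h, h'⟩⟩

theorem isIndecomposable_of_isLocalRing {X : C} [IsLocalRing (End X)] : IsIndecomposable X := by
  refine ⟨fun h => one_ne_zero (α := End X) (h.eq_of_src _ _), fun Y Z h => ?_⟩
  obtain ⟨i, p, j, q, h1, h2, h3⟩ := isDirectSum_iff.1 h
  -- An invertible idempotent is the identity, so the complementary one vanishes.
  have key : ∀ {Y Z : C} (i : Y ⟶ X) (p : X ⟶ Y) (j : Z ⟶ X) (q : X ⟶ Z), i ≫ p = 𝟙 Y →
      j ≫ q = 𝟙 Z → p ≫ i + q ≫ j = 𝟙 X → IsUnit (M := End X) (p ≫ i) → IsZero Z := by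
    intro Y Z i p j q h1 h2 h3 h4
    have h5 : (p ≫ i) = 𝟙 X := IsUnit.mul_left_cancel (M := End X) h4 (by
      change (p ≫ i) ≫ (p ≫ i) = 𝟙 X ≫ (p ≫ i)
      simp [reassoc_of% h1])
    have h6 : q ≫ j = 0 := by simpa [h5] using h3
    refine (IsZero.iff_id_eq_zero Z).2 ?_
    calc 𝟙 Z = j ≫ (q ≫ j) ≫ q := by simp [h2]
      _ = 0 := by rw [h6]; simp
  rcases IsLocalRing.isUnit_or_isUnit_of_add_one (R := End X) (a := p ≫ i) (b := q ≫ j) h3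
    with h | h
  · exact Or.inr (key i p j q h1 h2 h3 h)
  · exact Or.inl (key j q i p h2 h1 (by rw [add_comm, h3]) h)

/-! ### Finite direct sum decompositions -/

/-- `X` is the direct sum of the finite family `f`, witnessed by inclusions `j` and
projections `p`; this does not presuppose that the category has biproducts. -/
def IsDecomposition {ι : Type} [Fintype ι] (X : C) (f : ι → C) : Prop :=
  ∃ (j : ∀ i, f i ⟶ X) (p : ∀ i, X ⟶ f i),
    (∀ i, j i ≫ p i = 𝟙 (f i)) ∧ (∀ i k, i ≠ k → j i ≫ p k = 0) ∧ ∑ i, p i ≫ j i = 𝟙 X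

theorem IsDecomposition.congr {ι : Type} [Fintype ι] {X : C} {f g : ι → C}
    (h : IsDecomposition X f) (e : ∀ i, f i ≅ g i) : IsDecomposition X g := by
  obtain ⟨j, p, h1, h2, h3⟩ := h
  refine ⟨fun i => (e i).inv ≫ j i, fun i => p i ≫ (e i).hom, fun i => ?_, fun i k hik => ?_, ?_⟩
  · simp [reassoc_of% h1 i]
  · simp [reassoc_of% h2 i k hik]
  · simpa using h3

theorem IsDecomposition.reindex {ι κ : Type} [Fintype ι] [Fintype κ] {X : C} {f : ι → C}
    (h : IsDecomposition X f) (e : κ ≃ ι) : IsDecomposition X (f ∘ e) := by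
  obtain ⟨j, p, h1, h2, h3⟩ := h
  refine ⟨fun i => j (e i), fun i => p (e i), fun i => h1 _,
    fun i k hik => h2 _ _ (e.injective.ne hik), ?_⟩
  rw [← h3]
  exact e.sum_comp fun i => p i ≫ j i

theorem isDecomposition_of_isZero {X : C} (h : IsZero X) (f : Empty → C) :
    IsDecomposition X f :=
  ⟨fun i => i.elim, fun i => i.elim, fun i => i.elim, fun i => i.elim, h.eq_of_src _ _⟩

theorem isDecomposition_self (X : C) : IsDecomposition X (fun _ : Unit => X) :=
  ⟨fun _ => 𝟙 X, fun _ => 𝟙 X, by simp, fun i k h => (h rfl).elim, by simp⟩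

theorem IsDirectSum.isDecomposition {ι κ : Type} [Fintype ι] [Fintype κ] {X Y Z : C}
    {f : ι → C} {g : κ → C} (h : IsDirectSum X Y Z) (hf : IsDecomposition Y f)
    (hg : IsDecomposition Z g) : IsDecomposition X (Sum.elim f g) := by
  obtain ⟨i, p, j, q, h1, h2, h3⟩ := isDirectSum_iff.1 h
  have hiq : i ≫ q = 0 := comp_eq_zero_of_total h1 h2 h3
  have hjp : j ≫ p = 0 := comp_eq_zero_of_total h2 h1 (by rw [add_comm, h3])
  obtain ⟨jf, pf, f1, f2, f3⟩ := hf
  obtain ⟨jg, pg, g1, g2, g3⟩ := hg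
  refine ⟨fun s => Sum.rec (motive := fun s => Sum.elim f g s ⟶ X)
      (fun a => jf a ≫ i) (fun a => jg a ≫ j) s,
    fun s => Sum.rec (motive := fun s => X ⟶ Sum.elim f g s)
      (fun a => p ≫ pf a) (fun a => q ≫ pg a) s, ?_, ?_, ?_⟩
  · rintro (a | a)
    · simp [reassoc_of% h1, f1]
    · simp [reassoc_of% h2, g1]
  · rintro (a | a) (b | b) hab
    · have := f2 a b (by simpa using hab)
      simp [reassoc_of% h1, this]; rfl
    · simp [reassoc_of% hiq]; rfl
    · simp [reassoc_of% hjp]; rfl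
    · have := g2 a b (by simpa using hab)
      simp [reassoc_of% h2, this]; rfl
  · rw [Fintype.sum_sum_type]
    rw [← h3]
    congr 1
    · calc _ = p ≫ (∑ a, pf a ≫ jf a) ≫ i := by
            simp [Preadditive.comp_sum, Preadditive.sum_comp]
        _ = _ := by rw [f3]; simp
    · calc _ = q ≫ (∑ a, pg a ≫ jg a) ≫ j := by
            simp [Preadditive.comp_sum, Preadditive.sum_comp]
        _ = _ := by rw [g3]; simp

theorem IsDecomposition.nonempty_iso_biproduct [HasFiniteBiproducts C] {ι : Type} [Fintype ι]
    {X : C} {f : ι → C} (h : IsDecomposition X f) : Nonempty (X ≅ ⨁ f) := by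
  classical
  obtain ⟨j, p, h1, h2, h3⟩ := h
  refine ⟨⟨biproduct.lift p, biproduct.desc j, by rw [biproduct.lift_desc, h3], ?_⟩⟩
  ext k i
  by_cases hik : k = i
  · subst hik; simp [h1]
  · simp [h2 i k (Ne.symm hik), biproduct.ι_π_ne _ (Ne.symm hik)]

theorem IsDecomposition.isDirectSummand [IsIdempotentComplete C] {ι : Type} [Fintype ι]
    {X : C} {f : ι → C} (h : IsDecomposition X f) (i : ι) : IsDirectSummand (f i) X := by
  obtain ⟨j, p, h1, -, -⟩ := h
  exact isDirectSummand_of_retract (h1 i)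

theorem exists_isUnit_of_isUnit_sum {R : Type*} [Ring R] [IsLocalRing R] {ι : Type*}
    (s : Finset ι) (a : ι → R) (h : IsUnit (∑ i ∈ s, a i)) : ∃ i ∈ s, IsUnit (a i) := by
  classical
  induction s using Finset.induction_on with
  | empty => simp at h
  | insert i s hi ih =>
    rw [Finset.sum_insert hi] at h
    obtain ⟨c, hc⟩ := h
    have h1 : ↑c⁻¹ * a i + ↑c⁻¹ * ∑ i ∈ s, a i = 1 := by rw [← mul_add, ← hc, Units.inv_mul]
    rcases IsLocalRing.isUnit_or_isUnit_of_add_one h1 with h2 | h2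
    · exact ⟨i, by simp, by simpa using h2⟩
    · obtain ⟨k, hk, h3⟩ := ih (by simpa using h2)
      exact ⟨k, by simp [hk], h3⟩

/-- The uniqueness part of the Krull–Schmidt theorem: a summand with local endomorphism ring of
a finite direct sum of indecomposables is isomorphic to one of them. -/
theorem IsDecomposition.exists_iso_of_retract [IsIdempotentComplete C] {ι : Type} [Fintype ι]
    {X Y : C} {f : ι → C} (h : IsDecomposition X f) (hf : ∀ i, IsIndecomposable (f i))
    [IsLocalRing (End Y)] (hY : IsDirectSummand Y X) : ∃ i, Nonempty (Y ≅ f i) := by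
  obtain ⟨j, p, -, -, h3⟩ := h
  obtain ⟨a, b, hab⟩ := hY.exists_retract
  have hsum : ∑ i, a ≫ p i ≫ j i ≫ b = 𝟙 Y := by
    calc _ = a ≫ (∑ i, p i ≫ j i) ≫ b := by
          simp [Preadditive.comp_sum, Preadditive.sum_comp]
      _ = 𝟙 Y := by rw [h3]; simp [hab]
  -- The identity of `Y` is the sum of its factorizations through the `f i`; one is invertible.
  obtain ⟨i, -, hi⟩ := exists_isUnit_of_isUnit_sum (R := End Y) Finset.univ
    (fun i => a ≫ p i ≫ j i ≫ b) (by erw [hsum]; exact isUnit_one)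
  have : IsIso (a ≫ p i ≫ j i ≫ b) := (isUnit_iff_isIso _).1 hi
  refine ⟨i, (hf i).nonempty_iso_of_retract (isIndecomposable_of_isLocalRing (X := Y)).1
    (i := a ≫ p i) (p := j i ≫ b ≫ inv (a ≫ p i ≫ j i ≫ b)) ?_⟩
  have := IsIso.hom_inv_id (a ≫ p i ≫ j i ≫ b)
  simpa only [Category.assoc] using this

end Preadditive

/-! ### Finite-dimensional algebras without idempotents -/

/-- Fitting's lemma in ring form: in an algebraic algebra over a field every element `x` is
annihilated by some `X ^ k * q` with `q` prime to `X`, and a Bézout relation between the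
two factors produces an idempotent in `K[x]`. -/
theorem isLocalRing_of_forall_idempotent {K A : Type*} [Field K] [Ring A] [Algebra K A]
    [Algebra.IsIntegral K A] [Nontrivial A]
    (h : ∀ e : A, e * e = e → e = 0 ∨ e = 1) : IsLocalRing A := by
  have key : ∀ x : A, IsUnit x ∨ IsNilpotent x := by
    intro x
    obtain ⟨P, hP, hx⟩ := Algebra.IsIntegral.isIntegral (R := K) x
    obtain ⟨q, hq, hq'⟩ := Polynomial.exists_eq_pow_rootMultiplicity_mul_and_not_dvd P hP.ne_zero 0
    set k := P.rootMultiplicity 0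
    -- The exponent `k + 1` is positive, so that `x` is invertible as soon as its power is.
    simp only [Polynomial.C_0, sub_zero] at hq hq'
    have hcop : IsCoprime ((Polynomial.X : Polynomial K) ^ (k + 1)) q :=
      ((Polynomial.prime_X.coprime_iff_not_dvd).2 hq').pow_left
    obtain ⟨a, b, hab⟩ := hcop
    have hx' : Polynomial.aeval x P = 0 := hx
    have h0 : x ^ (k + 1) * Polynomial.aeval x q = 0 := by
      have : x ^ k * Polynomial.aeval x q = 0 := by rw [hq] at hx'; simpa using hx'
      rw [pow_succ', mul_assoc, this, mul_zero]
    have h1 : Polynomial.aeval x a * x ^ (k + 1) +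
        Polynomial.aeval x b * Polynomial.aeval x q = 1 := by
      simpa using congrArg (Polynomial.aeval x) hab
    have hc : Commute (Polynomial.aeval x a) (x ^ (k + 1)) := by
      have := (Commute.all a (Polynomial.X ^ (k + 1))).map (Polynomial.aeval x)
      simpa using this
    have hcq : Commute (Polynomial.aeval x b) (Polynomial.aeval x q) :=
      (Commute.all b q).map (Polynomial.aeval x)
    have hid : (Polynomial.aeval x a * x ^ (k + 1)) * (Polynomial.aeval x a * x ^ (k + 1))
        = Polynomial.aeval x a * x ^ (k + 1) := by
      have : (Polynomial.aeval x a * x ^ (k + 1)) *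
          (Polynomial.aeval x b * Polynomial.aeval x q) = 0 := by
        rw [hcq.eq, mul_assoc, ← mul_assoc (x ^ (k + 1)), h0]; simp
      calc _ = (Polynomial.aeval x a * x ^ (k + 1)) * (Polynomial.aeval x a * x ^ (k + 1) +
            Polynomial.aeval x b * Polynomial.aeval x q) := by rw [mul_add, this, add_zero]
        _ = _ := by rw [h1, mul_one]
    rcases h _ hid with h2 | h2
    · right
      refine ⟨k + 1, ?_⟩
      rw [h2, zero_add] at h1
      calc x ^ (k + 1) = x ^ (k + 1) * (Polynomial.aeval x q * Polynomial.aeval x b) := by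
            rw [← hcq.eq, h1, mul_one]
        _ = 0 := by rw [← mul_assoc, h0, zero_mul]
    · left
      have hu : IsUnit (x ^ (k + 1)) := isUnit_iff_exists.2 ⟨_, by rw [← hc.eq, h2], h2⟩
      exact (isUnit_pow_iff k.succ_ne_zero).1 hu
  refine ⟨fun {a b} hab => ?_⟩
  rcases key a with h1 | h1
  · exact Or.inl h1
  · right
    rw [← eq_sub_iff_add_eq'] at hab
    exact hab ▸ h1.isUnit_one_sub

/-! ### Functors to vector spaces that are determined by finitely many values -/

section Functor

variable {C : Type u} [Category.{v} C] {K : Type w} [Field K]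

/-- Every value of `M` is identified with a value at an object of the finite set `T` by a
structure map of `M`. -/
def IsSampledBy (T : Finset C) (M : C ⥤ ModuleCat.{w} K) : Prop :=
  ∀ x, ∃ t ∈ T, ∃ f : x ⟶ t, IsIso (M.map f)

theorem isIso_map_of_retract {M N : C ⥤ ModuleCat.{w} K} {i : N ⟶ M} {p : M ⟶ N}
    (h : i ≫ p = 𝟙 N) {x y : C} (f : x ⟶ y) [IsIso (M.map f)] : IsIso (N.map f) := by
  have hx : i.app x ≫ p.app x = 𝟙 _ := by rw [← NatTrans.comp_app, h]; rfl
  have hy : i.app y ≫ p.app y = 𝟙 _ := by rw [← NatTrans.comp_app, h]; rfl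
  refine ⟨i.app y ≫ inv (M.map f) ≫ p.app x, ?_, ?_⟩
  · rw [i.naturality_assoc, IsIso.hom_inv_id_assoc, hx]
  · simp only [Category.assoc]
    rw [← p.naturality, IsIso.inv_hom_id_assoc, hy]

theorem IsDirectSum.isIso_map {M N L : C ⥤ ModuleCat.{w} K} (h : IsDirectSum M N L) {x y : C}
    (f : x ⟶ y) [IsIso (N.map f)] [IsIso (L.map f)] : IsIso (M.map f) := by
  obtain ⟨i, p, j, q, h1, h2, h3⟩ := isDirectSum_iff.1 h
  have hiq := comp_eq_zero_of_total h1 h2 h3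
  have hjp := comp_eq_zero_of_total h2 h1 (by rw [add_comm, h3])
  have h3' : ∀ x, p.app x ≫ i.app x + q.app x ≫ j.app x = 𝟙 _ := fun x => by
    rw [← NatTrans.comp_app, ← NatTrans.comp_app, ← NatTrans.app_add, h3]; rfl
  have ip : ∀ x, i.app x ≫ p.app x = 𝟙 _ := fun x => by rw [← NatTrans.comp_app, h1]; rfl
  have jq : ∀ x, j.app x ≫ q.app x = 𝟙 _ := fun x => by rw [← NatTrans.comp_app, h2]; rfl
  have iq : ∀ x, i.app x ≫ q.app x = 0 := fun x => by rw [← NatTrans.comp_app, hiq]; rfl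
  have jp : ∀ x, j.app x ≫ p.app x = 0 := fun x => by rw [← NatTrans.comp_app, hjp]; rfl
  refine ⟨p.app y ≫ inv (N.map f) ≫ i.app x + q.app y ≫ inv (L.map f) ≫ j.app x, ?_, ?_⟩
  · rw [Preadditive.comp_add, p.naturality_assoc, q.naturality_assoc]
    simpa using h3' x
  · rw [Preadditive.add_comp]
    simp only [Category.assoc]
    rw [← i.naturality, ← j.naturality, IsIso.inv_hom_id_assoc, IsIso.inv_hom_id_assoc]
    exact h3' y

theorem IsSampledBy.of_isDirectSummand {T : Finset C} {M N : C ⥤ ModuleCat.{w} K}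
    (hM : IsSampledBy T M) (h : IsDirectSummand N M) : IsSampledBy T N := fun x => by
  obtain ⟨i, p, hip⟩ := h.exists_retract
  obtain ⟨t, ht, f, hf⟩ := hM x
  exact ⟨t, ht, f, isIso_map_of_retract hip f⟩

theorem app_injective_of_retract {M N : C ⥤ ModuleCat.{w} K} {i : N ⟶ M} {p : M ⟶ N}
    (h : i ≫ p = 𝟙 N) (x : C) : Function.Injective (i.app x).hom := by
  have hx : i.app x ≫ p.app x = 𝟙 _ := by rw [← NatTrans.comp_app, h]; rfl
  have hx' : (p.app x).hom ∘ₗ (i.app x).hom = LinearMap.id := by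
    rw [← ModuleCat.hom_comp, hx]; rfl
  exact Function.LeftInverse.injective (g := (p.app x).hom) fun v => LinearMap.congr_fun hx' v

theorem finiteDimensional_of_isDirectSummand {M N : C ⥤ ModuleCat.{w} K}
    (h : IsDirectSummand N M) (x : C) [FiniteDimensional K (M.obj x)] :
    FiniteDimensional K (N.obj x) := by
  obtain ⟨i, p, hip⟩ := h.exists_retract
  exact FiniteDimensional.of_injective _ (app_injective_of_retract hip x)

/-- The values of a direct sum are the products of the values of the summands. -/
theorem IsDirectSum.nonempty_linearEquiv {M N L : C ⥤ ModuleCat.{w} K} (h : IsDirectSum M N L)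
    (x : C) : Nonempty (M.obj x ≃ₗ[K] N.obj x × L.obj x) := by
  obtain ⟨i, p, j, q, h1, h2, h3⟩ := isDirectSum_iff.1 h
  have hiq := comp_eq_zero_of_total h1 h2 h3
  have hjp := comp_eq_zero_of_total h2 h1 (by rw [add_comm, h3])
  have h3' : ∀ v, (i.app x).hom ((p.app x).hom v) + (j.app x).hom ((q.app x).hom v) = v :=
    fun v => by
      have : p.app x ≫ i.app x + q.app x ≫ j.app x = 𝟙 _ := by
        rw [← NatTrans.comp_app, ← NatTrans.comp_app, ← NatTrans.app_add, h3]; rfl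
      exact LinearMap.congr_fun (congrArg ModuleCat.Hom.hom this) v
  have aux : ∀ {A B D : C ⥤ ModuleCat.{w} K} {a : A ⟶ B} {b : B ⟶ D} {c : A ⟶ D}, a ≫ b = c →
      ∀ v, (b.app x).hom ((a.app x).hom v) = (c.app x).hom v := by
    rintro A B D a b c rfl v; rfl
  refine ⟨LinearEquiv.ofLinearMap ((p.app x).hom.prod (q.app x).hom)
    ((i.app x).hom.coprod (j.app x).hom) ?_ ?_⟩
  · refine LinearMap.ext fun v => ?_
    have e1 := aux h1 v.1
    have e2 := aux h2 v.2
    have e3 := aux hiq v.1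
    have e4 := aux hjp v.2
    ext <;> simp [e1, e2, e3, e4]
  · exact LinearMap.ext fun v => h3' v

theorem IsDirectSum.finiteDimensional {M N L : C ⥤ ModuleCat.{w} K} (h : IsDirectSum M N L)
    (x : C) [FiniteDimensional K (N.obj x)] [FiniteDimensional K (L.obj x)] :
    FiniteDimensional K (M.obj x) := by
  obtain ⟨e⟩ := h.nonempty_linearEquiv x
  exact e.symm.finiteDimensional

theorem IsDirectSum.finrank_eq {M N L : C ⥤ ModuleCat.{w} K} (h : IsDirectSum M N L) (x : C)
    [FiniteDimensional K (M.obj x)] :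
    Module.finrank K (M.obj x) = Module.finrank K (N.obj x) + Module.finrank K (L.obj x) := by
  have := finiteDimensional_of_isDirectSummand h.isDirectSummand x
  have := finiteDimensional_of_isDirectSummand h.symm.isDirectSummand x
  obtain ⟨e⟩ := h.nonempty_linearEquiv x
  rw [e.finrank_eq, Module.finrank_prod]

theorem isZero_iff_subsingleton {M : C ⥤ ModuleCat.{w} K} :
    IsZero M ↔ ∀ x, Subsingleton (M.obj x) := by
  rw [Functor.isZero_iff]
  exact forall_congr' fun x => ModuleCat.isZero_iff_subsingleton

theorem IsSampledBy.isZero {T : Finset C} {M : C ⥤ ModuleCat.{w} K} (hM : IsSampledBy T M)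
    (h : ∀ t ∈ T, Subsingleton (M.obj t)) : IsZero M := by
  refine isZero_iff_subsingleton.2 fun x => ?_
  obtain ⟨t, ht, f, hf⟩ := hM x
  have := h t ht
  exact (asIso (M.map f)).toLinearEquiv.toEquiv.subsingleton

/-- A pointwise finite functor determined by finitely many values is a finite direct sum of
indecomposable ones, by induction on the sum of the dimensions of those values. -/
theorem IsSampledBy.exists_isDecomposition {T : Finset C} {M : C ⥤ ModuleCat.{w} K}
    (hM : IsSampledBy T M) (hfin : ∀ x, FiniteDimensional K (M.obj x)) :
    ∃ (ι : Type) (_ : Fintype ι) (f : ι → C ⥤ ModuleCat.{w} K),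
      IsDecomposition M f ∧ ∀ i, IsIndecomposable (f i) := by
  induction h : ∑ t ∈ T, Module.finrank K (M.obj t) using Nat.strong_induction_on
    generalizing M with
  | _ n ih =>
    by_cases h0 : IsZero M
    · exact ⟨Empty, inferInstance, Empty.elim, isDecomposition_of_isZero h0 _, fun i => i.elim⟩
    by_cases h1 : IsIndecomposable M
    · exact ⟨Unit, inferInstance, fun _ => M, isDecomposition_self M, fun _ => h1⟩
    obtain ⟨Y, Z, hYZ, hY, hZ⟩ : ∃ Y Z, IsDirectSum M Y Z ∧ ¬ IsZero Y ∧ ¬ IsZero Z := by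
      by_contra! hc
      exact h1 ⟨h0, fun Y Z hYZ => or_iff_not_imp_left.2 fun hY => hc Y Z hYZ hY⟩
    have pos : ∀ {L : C ⥤ ModuleCat.{w} K}, IsDirectSummand L M → ¬ IsZero L →
        0 < ∑ t ∈ T, Module.finrank K (L.obj t) := by
      intro L hL hL0
      by_contra hc
      refine hL0 ((hM.of_isDirectSummand hL).isZero fun t ht => ?_)
      have := finiteDimensional_of_isDirectSummand hL t
      exact Module.finrank_zero_iff.1 (Finset.sum_eq_zero_iff.1 (Nat.eq_zero_of_not_pos hc) t ht)
    have sum : ∑ t ∈ T, Module.finrank K (M.obj t) = ∑ t ∈ T, Module.finrank K (Y.obj t) +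
        ∑ t ∈ T, Module.finrank K (Z.obj t) := by
      rw [← Finset.sum_add_distrib]
      exact Finset.sum_congr rfl fun t _ => hYZ.finrank_eq t
    have hYM := hYZ.isDirectSummand
    have hZM := hYZ.symm.isDirectSummand
    have pY := pos hYM hY
    have pZ := pos hZM hZ
    obtain ⟨ι, _, f, hf, hf'⟩ := ih _ (by omega) (hM.of_isDirectSummand hYM)
      (fun x => finiteDimensional_of_isDirectSummand hYM x) rfl
    obtain ⟨κ, _, g, hg, hg'⟩ := ih _ (by omega) (hM.of_isDirectSummand hZM)
      (fun x => finiteDimensional_of_isDirectSummand hZM x) rfl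
    exact ⟨ι ⊕ κ, inferInstance, Sum.elim f g, hYZ.isDecomposition hf hg, by
      rintro (a | a); exacts [hf' a, hg' a]⟩

/-- The endomorphism algebra is finite-dimensional because an endomorphism is determined by its
components at `T`, so Fitting's lemma applies. -/
theorem IsSampledBy.isLocalRing_end {T : Finset C} {M : C ⥤ ModuleCat.{w} K}
    (hM : IsSampledBy T M) (hfin : ∀ x, FiniteDimensional K (M.obj x))
    (hind : IsIndecomposable M) : IsLocalRing (End M) := by
  let ev : End M →ₗ[K] ∀ t : T, (M.obj t →ₗ[K] M.obj t) :=
    { toFun := fun φ t => (NatTrans.app φ t).hom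
      map_add' := fun _ _ => rfl
      map_smul' := fun _ _ => rfl }
  have hev : Function.Injective ev := by
    intro φ ψ h
    refine NatTrans.ext (funext fun x => ?_)
    obtain ⟨t, ht, f, hf⟩ := hM x
    have ht' : NatTrans.app φ t = NatTrans.app ψ t := ModuleCat.hom_ext (congrFun h ⟨t, ht⟩)
    rw [← cancel_mono (M.map f), ← NatTrans.naturality, ← NatTrans.naturality, ht']
  have : FiniteDimensional K (End M) := FiniteDimensional.of_injective ev hev
  have := nontrivial_end hind.1
  exact isLocalRing_of_forall_idempotent (K := K) fun e he => hind.eq_zero_or_eq_id e he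

end Functor

/-! ### Points and paths of the circle -/

theorem cov_surjective : Function.Surjective cov := by
  rintro ⟨x⟩
  obtain ⟨t, rfl⟩ := QuotientAddGroup.mk_surjective x
  exact ⟨t, rfl⟩

theorem cov_eq_cov_iff {s t : ℝ} : cov s = cov t ↔ ∃ n : ℤ, s = t + 2 * n * Real.pi := by
  have h : cov s = cov t ↔ ((s - t : ℝ) : AddCircle (2 * Real.pi)) = 0 := by
    rw [AddCircle.coe_sub, sub_eq_zero]
    exact ⟨fun h => congrArg S1.point h, fun h => S1.ext h⟩
  rw [h, AddCircle.coe_eq_zero_iff]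
  refine exists_congr fun n => ?_
  rw [zsmul_eq_mul]
  constructor <;> intro h <;> linarith

theorem cov_add_two_mul_int_mul_pi (s : ℝ) (n : ℤ) : cov (s + 2 * n * Real.pi) = cov s :=
  cov_eq_cov_iff.2 ⟨n, rfl⟩

theorem S1.Path.cov_add_length {x y : S1} (f : S1.Path x y) {r : ℝ} (hr : cov r = x) :
    cov (r + f.length) = y := by
  rw [← cov_rotate, hr, f.rotate_eq]

theorem S1.Path.cov_sub_length {x y : S1} (f : S1.Path x y) {r : ℝ} (hr : cov r = y) :
    cov (r - f.length) = x := by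
  obtain ⟨t, ht⟩ := cov_surjective x
  have h := f.cov_add_length ht
  obtain ⟨n, hn⟩ := cov_eq_cov_iff.1 (h.trans hr.symm)
  exact (cov_eq_cov_iff.2 ⟨-n, by push_cast; linarith⟩ : cov (r - f.length) = cov t).trans ht

/-! ### Structure maps of strings -/

section String

variable {K : Type w} [Field K] {U V : BoundedInterval}

/-- A bounded interval has finitely many points over each point of the circle, so that strings
are pointwise finite. -/
instance (U : BoundedInterval) (x : S1) : Finite (U.Fiber x) := by
  obtain ⟨t, rfl⟩ := cov_surjective x
  obtain ⟨A, hA⟩ := U.bddBelow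
  obtain ⟨B, hB⟩ := U.bddAbove
  have hp := Real.two_pi_pos
  have h : ∀ b : U.Fiber (cov t), ∃ n : ℤ, b.val = t + 2 * n * Real.pi := fun b =>
    cov_eq_cov_iff.1 b.cov_eq
  choose n hn using h
  have hmem : ∀ b, n b ∈ Set.Icc ⌊(A - t) / (2 * Real.pi)⌋ ⌈(B - t) / (2 * Real.pi)⌉ := by
    intro b
    have h1 := hA b.mem
    have h2 := hB b.mem
    have h3 := hn b
    constructor
    · refine Int.floor_le_iff.2 ?_
      rw [div_lt_iff₀ hp]; nlinarith
    · refine Int.le_ceil_iff.2 ?_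
      rw [lt_div_iff₀ hp]; nlinarith
  refine Finite.of_injective (fun b => (⟨n b, hmem b⟩ : Set.Icc _ _)) fun b c h => ?_
  have h' : n b = n c := congrArg Subtype.val h
  exact BoundedInterval.Fiber.ext (by rw [hn, hn, h'])

instance (U : BoundedInterval) (x : S1) : FiniteDimensional K ((stringRep K U).obj x) :=
  inferInstanceAs (FiniteDimensional K (U.Fiber x →₀ K))

variable (K U) in
/-- The action of a path on a string, as a linear map between spaces of finitely supported
functions. -/
def stringMap {x y : S1} (f : S1.Path x y) : (U.Fiber x →₀ K) →ₗ[K] (U.Fiber y →₀ K) :=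
  Finsupp.linearCombination K (stringStep K U f)

theorem stringMap_single_of_mem {x y : S1} (f : S1.Path x y) (b : U.Fiber x) (c : K)
    (h : b.val + f.length ∈ U.carrier) : stringMap K U f (Finsupp.single b c) =
      Finsupp.single ⟨b.val + f.length, h, f.cov_add_length b.cov_eq⟩ c := by
  rw [stringMap, Finsupp.linearCombination_single, stringStep, dif_pos h, Finsupp.smul_single,
    smul_eq_mul, mul_one]

theorem stringMap_single_of_notMem {x y : S1} (f : S1.Path x y) (b : U.Fiber x) (c : K)
    (h : b.val + f.length ∉ U.carrier) : stringMap K U f (Finsupp.single b c) = 0 := by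
  rw [stringMap, Finsupp.linearCombination_single, stringStep, dif_neg h, smul_zero]

open Classical in
/-- The coefficients of the image of `v` under a path are coefficients of `v`. -/
theorem stringMap_apply {x y : S1} (f : S1.Path x y) (v : U.Fiber x →₀ K) (c : U.Fiber y) :
    stringMap K U f v c = if h : c.val - f.length ∈ U.carrier then
      v ⟨c.val - f.length, h, f.cov_sub_length c.cov_eq⟩ else 0 := by
  induction v using Finsupp.induction_linear with
  | zero => simp
  | add v w hv hw =>
    rw [map_add, Finsupp.add_apply, hv, hw]
    split_ifs <;> simp
  | single b a =>
    by_cases hb : b.val + f.length ∈ U.carrier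
    · rw [stringMap_single_of_mem f b a hb]
      by_cases hc : c.val = b.val + f.length
      · have hc' : c.val - f.length = b.val := by linarith
        have hm : c.val - f.length ∈ U.carrier := hc' ▸ b.mem
        rw [dif_pos hm]
        have e1 : (⟨b.val + f.length, hb, f.cov_add_length b.cov_eq⟩ : U.Fiber y) = c :=
          BoundedInterval.Fiber.ext hc.symm
        have e2 : (⟨c.val - f.length, hm, f.cov_sub_length c.cov_eq⟩ : U.Fiber x) = b :=
          BoundedInterval.Fiber.ext hc'
        rw [e1, e2, Finsupp.single_eq_same, Finsupp.single_eq_same]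
      · rw [Finsupp.single_eq_of_ne (fun h => hc (congrArg BoundedInterval.Fiber.val h))]
        split_ifs with hm
        · rw [Finsupp.single_eq_of_ne]
          intro h
          have := congrArg BoundedInterval.Fiber.val h
          exact hc (by simp only at this; linarith)
        · rfl
    · rw [stringMap_single_of_notMem f b a hb, Finsupp.zero_apply]
      split_ifs with hm
      · rw [Finsupp.single_eq_of_ne]
        intro h
        have := congrArg BoundedInterval.Fiber.val h
        have h2 : b.val + f.length = c.val := by simp only at this; linarith
        exact hb (h2 ▸ c.mem)
      · rfl

/-- A path acts invertibly on a string exactly if no lift of it enters or leaves the interval. -/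
theorem isIso_stringRep_map_iff {x y : S1} (f : S1.Path x y) :
    IsIso ((stringRep K U).map f) ↔
      ∀ r, cov r = x → (r ∈ U.carrier ↔ r + f.length ∈ U.carrier) := by
  rw [ConcreteCategory.isIso_iff_bijective]
  change Function.Bijective (stringMap K U f) ↔ _
  constructor
  · rintro ⟨hinj, hsurj⟩ r hr
    constructor
    · intro h
      by_contra h'
      have h0 := hinj ((stringMap_single_of_notMem f (⟨r, h, hr⟩ : U.Fiber x) (1 : K) h').trans
        (map_zero _).symm)
      exact one_ne_zero (Finsupp.single_eq_zero.1 h0)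
    · intro h
      by_contra h'
      let c : U.Fiber y := ⟨r + f.length, h, f.cov_add_length hr⟩
      obtain ⟨v, hv⟩ := hsurj (Finsupp.single c (1 : K))
      have := stringMap_apply f v c
      rw [hv, dif_neg (by simpa [c] using h'), Finsupp.single_eq_same] at this
      exact one_ne_zero this
  · intro h
    constructor
    · refine (injective_iff_map_eq_zero _).2 fun v hv => Finsupp.ext fun b => ?_
      have hb := (h _ b.cov_eq).1 b.mem
      have := stringMap_apply f v ⟨b.val + f.length, hb, f.cov_add_length b.cov_eq⟩
      rw [hv, dif_pos (by simpa using b.mem)] at this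
      refine Eq.trans ?_ this.symm
      exact congrArg v (BoundedInterval.Fiber.ext (by simp))
    · refine LinearMap.range_eq_top.1 (eq_top_iff.2 fun w _ => ?_)
      induction w using Finsupp.induction_linear with
      | zero => exact zero_mem _
      | add v w hv hw => exact add_mem (hv trivial) (hw trivial)
      | single c a =>
        have hm : c.val - f.length ∈ U.carrier :=
          (h _ (f.cov_sub_length c.cov_eq)).2 (by simpa using c.mem)
        refine ⟨Finsupp.single ⟨c.val - f.length, hm, f.cov_sub_length c.cov_eq⟩ a, ?_⟩
        rw [stringMap_single_of_mem _ _ _ (by simpa using c.mem)]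
        exact congrArg (Finsupp.single · a) (BoundedInterval.Fiber.ext (by simp))

theorem stringRep_isZero_iff : IsZero (stringRep K U) ↔ U.carrier = ∅ := by
  rw [isZero_iff_subsingleton]
  constructor
  · intro h
    refine Set.eq_empty_of_forall_notMem fun r hr => ?_
    have h1 := h (cov r)
    have h2 : (Finsupp.single (⟨r, hr, rfl⟩ : U.Fiber (cov r)) (1 : K)) = 0 := h1.elim _ _
    exact one_ne_zero (Finsupp.single_eq_zero.1 h2)
  · intro h x
    have : IsEmpty (U.Fiber x) := ⟨fun b => by simpa [h] using b.mem⟩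
    exact inferInstanceAs (Subsingleton (U.Fiber x →₀ K))

/-- Strings do not change, up to isomorphism, under translation by multiples of `2π`. -/
theorem nonempty_stringRep_iso (n : ℤ)
    (h : ∀ r, r ∈ U.carrier ↔ r + 2 * n * Real.pi ∈ V.carrier) :
    Nonempty (stringRep K U ≅ stringRep K V) := by
  let e (x : S1) : U.Fiber x ≃ V.Fiber x :=
    { toFun := fun b => ⟨b.val + 2 * n * Real.pi, (h _).1 b.mem, by
        rw [cov_add_two_mul_int_mul_pi, b.cov_eq]⟩
      invFun := fun b => ⟨b.val - 2 * n * Real.pi, (h _).2 (by simpa using b.mem), by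
        rw [← cov_add_two_mul_int_mul_pi _ n, sub_add_cancel, b.cov_eq]⟩
      left_inv := fun b => BoundedInterval.Fiber.ext (by simp)
      right_inv := fun b => BoundedInterval.Fiber.ext (by simp) }
  let E (x : S1) : (U.Fiber x →₀ K) ≃ₗ[K] (V.Fiber x →₀ K) := Finsupp.domLCongr (e x)
  refine ⟨NatIso.ofComponents (fun x => (E x).toModuleIso) fun {x y} f => ?_⟩
  ext1
  refine Finsupp.lhom_ext' fun b => LinearMap.ext_ring ?_
  change E y (stringMap K U f (Finsupp.single b 1)) = stringMap K V f (E x (Finsupp.single b 1))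
  have e1 : (e x b).val + S1.Path.length f = b.val + S1.Path.length f + 2 * n * Real.pi := by
    change b.val + 2 * n * Real.pi + S1.Path.length f = _
    ring
  have e2 : E x (Finsupp.single b 1) = Finsupp.single (e x b) 1 := Finsupp.domLCongr_single ..
  rw [e2]
  by_cases hb : b.val + S1.Path.length f ∈ U.carrier
  · rw [stringMap_single_of_mem f b _ hb,
      stringMap_single_of_mem f (e x b) _ (e1 ▸ (h _).1 hb)]
    refine (Finsupp.domLCongr_single ..).trans ?_
    exact congrArg (Finsupp.single · 1) (BoundedInterval.Fiber.ext e1.symm)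
  · rw [stringMap_single_of_notMem f b _ hb,
      stringMap_single_of_notMem f (e x b) _ (e1 ▸ fun hc => hb ((h _).2 hc)), map_zero]

end String

/-! ### Endomorphisms of strings -/

section Socle

variable {K : Type w} [Field K] {U : BoundedInterval} {a b : ℝ}

/-- The component of an endomorphism of a string at a point of the circle. -/
def endApp (φ : stringRep K U ⟶ stringRep K U) (x : S1) :
    (U.Fiber x →₀ K) →ₗ[K] (U.Fiber x →₀ K) :=
  (φ.app x).hom

theorem endApp_stringMap (φ : stringRep K U ⟶ stringRep K U) {x y : S1} (f : S1.Path x y)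
    (v : U.Fiber x →₀ K) :
    endApp φ y (stringMap K U f v) = stringMap K U f (endApp φ x v) :=
  LinearMap.congr_fun (congrArg ModuleCat.Hom.hom (φ.naturality f)) v

/-- The point `b` of `(a, b]`. The corresponding basis vector spans the socle of the string. -/
def topPoint (hab : a < b) : (BoundedInterval.Ioc a b).Fiber (cov b) :=
  ⟨b, ⟨hab, le_rfl⟩, rfl⟩

/-- The image in the circle of the path from a point of the fibre over `x` to `b`. -/
def pathToTop {x : S1} (r : (BoundedInterval.Ioc a b).Fiber x) : S1.Path x (cov b) :=
  ⟨b - r.val, sub_nonneg.2 r.mem.2, by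
    obtain ⟨t, ht, rfl⟩ := r
    simp [cov_rotate]⟩

theorem topPoint_val_sub_pathToTop_length (hab : a < b) {x : S1}
    (r : (BoundedInterval.Ioc a b).Fiber x) :
    (topPoint hab).val - (pathToTop r).length = r.val := by
  simp [topPoint, pathToTop]

theorem stringMap_pathToTop_apply (hab : a < b) {x : S1}
    (r : (BoundedInterval.Ioc a b).Fiber x) (v : (BoundedInterval.Ioc a b).Fiber x →₀ K) :
    stringMap K _ (pathToTop r) v (topPoint hab) = v r := by
  have e := topPoint_val_sub_pathToTop_length hab r
  rw [stringMap_apply, dif_pos (e ▸ r.mem)]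
  exact congrArg v (BoundedInterval.Fiber.ext e)

/-- Every nonzero vector of the string of `(a, b]` can be moved to the socle: the path that
takes the first point of its support to `b` kills all other basis vectors in the support. -/
theorem exists_map_eq_single_topPoint (hab : a < b) {x : S1}
    (v : (BoundedInterval.Ioc a b).Fiber x →₀ K) (hv : v ≠ 0) :
    ∃ (f : S1.Path x (cov b)) (c : K), c ≠ 0 ∧
      stringMap K _ f v = Finsupp.single (topPoint hab) c := by
  obtain ⟨r, hr, hmin⟩ := Finset.exists_min_image v.support BoundedInterval.Fiber.val
    (Finsupp.support_nonempty_iff.2 hv)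
  refine ⟨pathToTop r, v r, Finsupp.mem_support_iff.1 hr, Finsupp.ext fun c => ?_⟩
  by_cases hc : c = topPoint hab
  · rw [hc, stringMap_pathToTop_apply, Finsupp.single_eq_same]
  · rw [Finsupp.single_eq_of_ne hc, stringMap_apply]
    split_ifs with h
    · by_contra h0
      have h1 : r.val ≤ c.val - (b - r.val) := hmin _ (Finsupp.mem_support_iff.2 h0)
      exact hc (BoundedInterval.Fiber.ext (le_antisymm c.mem.2 (show b ≤ c.val by linarith)))
    · rfl

/-- An endomorphism of the string of `(a, b]` preserves the socle, since the latter consists of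
the vectors over `b` that are killed by all paths of positive length. -/
theorem exists_endApp_single_topPoint (hab : a < b)
    (φ : stringRep K (BoundedInterval.Ioc a b) ⟶ stringRep K (BoundedInterval.Ioc a b)) :
    ∃ c : K, endApp φ (cov b) (Finsupp.single (topPoint hab) 1) =
      Finsupp.single (topPoint hab) c := by
  set v := endApp φ (cov b) (Finsupp.single (topPoint hab) 1) with hv
  refine ⟨v (topPoint hab), Finsupp.ext fun c => ?_⟩
  by_cases hc : c = topPoint hab
  · rw [hc, Finsupp.single_eq_same]
  · rw [Finsupp.single_eq_of_ne hc]
    have hlt : c.val < b :=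
      lt_of_le_of_ne c.mem.2 fun h => hc (BoundedInterval.Fiber.ext h)
    -- The path taking `c` to `b` kills the socle, hence `v`.
    have h0 : stringMap K _ (pathToTop c) (Finsupp.single (topPoint hab) 1) = 0 := by
      refine stringMap_single_of_notMem _ _ _ fun h => ?_
      have h3 : b + (b - c.val) ≤ b := h.2
      linarith
    rw [← stringMap_pathToTop_apply hab c v, hv, ← endApp_stringMap, h0, map_zero,
      Finsupp.zero_apply]

theorem isIso_of_endApp_single_topPoint (hab : a < b)
    (φ : stringRep K (BoundedInterval.Ioc a b) ⟶ stringRep K (BoundedInterval.Ioc a b)) {c : K}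
    (hc : c ≠ 0) (hφ : endApp φ (cov b) (Finsupp.single (topPoint hab) 1) =
      Finsupp.single (topPoint hab) c) : IsIso φ := by
  refine (NatTrans.isIso_iff_isIso_app φ).2 fun x => ?_
  rw [ConcreteCategory.isIso_iff_bijective]
  change Function.Bijective (endApp φ x)
  have hinj : Function.Injective (endApp φ x) := by
    refine (injective_iff_map_eq_zero _).2 fun v hv => ?_
    by_contra hv0
    obtain ⟨f, d, hd, hf⟩ := exists_map_eq_single_topPoint hab v hv0
    have h1 := endApp_stringMap φ f v
    rw [hv, map_zero, hf, ← mul_one d, ← smul_eq_mul, ← Finsupp.smul_single, map_smul, hφ,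
      Finsupp.smul_single, smul_eq_mul] at h1
    exact mul_ne_zero hd hc (Finsupp.single_eq_zero.1 h1)
  exact ⟨hinj, LinearMap.surjective_of_injective hinj⟩

/-- The endomorphism ring of the string of `(a, b]` is local, since an endomorphism is invertible
as soon as it does not vanish on the one-dimensional socle. -/
theorem isLocalRing_end_stringRep_Ioc (hab : a < b) :
    IsLocalRing (End (stringRep K (BoundedInterval.Ioc a b))) := by
  have : Nontrivial (End (stringRep K (BoundedInterval.Ioc a b))) := nontrivial_end fun h =>
    (Set.nonempty_Ioc.2 hab).ne_empty (stringRep_isZero_iff.1 h)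
  refine ⟨fun {φ ψ} h => ?_⟩
  obtain ⟨c, hc⟩ := exists_endApp_single_topPoint hab φ
  obtain ⟨d, hd⟩ := exists_endApp_single_topPoint hab ψ
  have hcd : c + d = 1 := by
    have h1 : endApp φ (cov b) (Finsupp.single (topPoint hab) 1) +
        endApp ψ (cov b) (Finsupp.single (topPoint hab) 1) =
        Finsupp.single (topPoint hab) (1 : K) :=
      congrArg (fun χ => endApp χ (cov b) (Finsupp.single (topPoint hab) (1 : K))) h
    rw [hc, hd, ← Finsupp.single_add] at h1
    exact Finsupp.single_injective _ h1
  by_cases h0 : c = 0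
  · right
    exact (isUnit_iff_isIso _).2 (isIso_of_endApp_single_topPoint hab ψ
      (by rintro rfl; simp [h0] at hcd) hd)
  · left
    exact (isUnit_iff_isIso _).2 (isIso_of_endApp_single_topPoint hab φ h0 hc)

end Socle

variable {m : ℕ}

/-! ### The points of an ∞-gon -/

namespace InfinityGon

variable (Z : InfinityGon m)

theorem acc_lt_pt (p : Fin m) (k : ℤ) : Z.acc p.castSucc < Z.pt p k :=
  ((Z.pt_strictMono p).monotone.le_of_tendsto (Z.tendsto_atBot p) (k - 1)).trans_lt
    (Z.pt_strictMono p (by omega))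

theorem pt_lt_acc (p : Fin m) (k : ℤ) : Z.pt p k < Z.acc p.succ :=
  (Z.pt_strictMono p (show k < k + 1 by omega)).trans_le
    ((Z.pt_strictMono p).monotone.ge_of_tendsto (Z.tendsto_atTop p) (k + 1))

theorem acc_nonneg (p : Fin (m + 1)) : 0 ≤ Z.acc p :=
  Z.acc_zero.ge.trans (Z.acc_strictMono.monotone (Fin.zero_le p))

theorem acc_le_two_pi (p : Fin (m + 1)) : Z.acc p ≤ 2 * Real.pi :=
  (Z.acc_strictMono.monotone (Fin.le_last p)).trans Z.acc_last.le

theorem pt_mem_Ioo (p : Fin m) (k : ℤ) : Z.pt p k ∈ Set.Ioo 0 (2 * Real.pi) :=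
  ⟨(Z.acc_nonneg _).trans_lt (Z.acc_lt_pt p k), (Z.pt_lt_acc p k).trans_le (Z.acc_le_two_pi _)⟩

theorem pt_mem_preimage (p : Fin m) (k : ℤ) : Z.pt p k ∈ Z.preimage := ⟨p, k, 0, by simp⟩

theorem preimage_add {x : ℝ} (hx : x ∈ Z.preimage) (n : ℤ) :
    x + 2 * n * Real.pi ∈ Z.preimage := by
  obtain ⟨p, k, l, rfl⟩ := hx
  exact ⟨p, k, l + n, by push_cast; ring⟩

/-- A real number in `[0, 2π)` lies between two consecutive accumulation points. -/
theorem exists_acc_le_lt {x : ℝ} (h0 : 0 ≤ x) (h1 : x < 2 * Real.pi) :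
    ∃ p : Fin m, Z.acc p.castSucc ≤ x ∧ x < Z.acc p.succ := by
  classical
  obtain ⟨q, hq, hmax⟩ := Finset.exists_max_image
    (Finset.univ.filter fun q : Fin (m + 1) => Z.acc q ≤ x) id
    ⟨0, by simpa [Z.acc_zero] using h0⟩
  have hqx : Z.acc q ≤ x := (Finset.mem_filter.1 hq).2
  have hlast : q ≠ Fin.last m := by
    rintro rfl
    rw [Z.acc_last] at hqx
    linarith
  obtain ⟨p, rfl⟩ := Fin.exists_castSucc_eq.2 hlast
  refine ⟨p, hqx, ?_⟩
  by_contra! hc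
  have := hmax p.succ (by simpa using hc)
  exact absurd this (not_le.2 Fin.castSucc_lt_succ)

theorem eq_of_mem_Ioo {p q : Fin m} {x : ℝ} (h1 : Z.acc p.castSucc < x) (h2 : x < Z.acc p.succ)
    (h3 : Z.acc q.castSucc < x) (h4 : x < Z.acc q.succ) : p = q := by
  have h5 := Z.acc_strictMono.lt_iff_lt.1 (h1.trans h4)
  have h6 := Z.acc_strictMono.lt_iff_lt.1 (h3.trans h2)
  simp only [Fin.lt_def, Fin.val_castSucc, Fin.val_succ] at h5 h6
  exact Fin.ext (by omega)

/-- The half-open intervals between consecutive points `pt p k` cover the open interval between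
two consecutive accumulation points. -/
theorem exists_pt_lt_le {p : Fin m} {x : ℝ} (h1 : Z.acc p.castSucc < x)
    (h2 : x < Z.acc p.succ) : ∃ k, Z.pt p k < x ∧ x ≤ Z.pt p (k + 1) := by
  obtain ⟨A, hA⟩ := ((Z.tendsto_atBot p).eventually_lt_const h1).exists
  obtain ⟨B, hB⟩ := ((Z.tendsto_atTop p).eventually_const_lt h2).exists
  obtain ⟨k, hk, hmax⟩ := Int.exists_greatest_of_bdd (P := fun k => Z.pt p k < x)
    ⟨B, fun z hz => ((Z.pt_strictMono p).lt_iff_lt.1 (hz.trans hB)).le⟩ ⟨A, hA⟩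
  refine ⟨k, hk, ?_⟩
  by_contra! hc
  have := hmax _ hc
  omega

/-- A multiple of `2π` that moves a point of `(0, 2π)` into `(0, 2π)` vanishes. -/
theorem eq_zero_of_add_mem {x : ℝ} {n : ℤ} (h0 : 0 ≤ x) (h1 : x < 2 * Real.pi)
    (h2 : 0 ≤ x + 2 * n * Real.pi) (h3 : x + 2 * n * Real.pi < 2 * Real.pi) : n = 0 := by
  have hp := Real.pi_pos
  have h4 : (n : ℝ) < 1 := by nlinarith
  have h5 : (-1 : ℝ) < n := by nlinarith
  have h6 : n < 1 := by exact_mod_cast h4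
  have h7 : -1 < n := by exact_mod_cast h5
  omega

/-- There are no points of the ∞-gon between a point and its successor. -/
theorem le_or_le_of_mem_preimage {x : ℝ} (hx : x ∈ Z.preimage) (p : Fin m) (k : ℤ) :
    x ≤ Z.pt p k ∨ Z.pt p (k + 1) ≤ x := by
  by_contra! hc
  obtain ⟨q, l, n, rfl⟩ := hx
  have h1 := Z.pt_mem_Ioo p k
  have h2 := Z.pt_mem_Ioo p (k + 1)
  have h3 := Z.pt_mem_Ioo q l
  obtain rfl : n = 0 := eq_zero_of_add_mem h3.1.le h3.2 (h1.1.trans hc.1).le (hc.2.trans h2.2)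
  simp only [Int.cast_zero, mul_zero, zero_mul, add_zero] at hc
  obtain rfl : p = q := Z.eq_of_mem_Ioo ((Z.acc_lt_pt p k).trans hc.1)
    (hc.2.trans (Z.pt_lt_acc _ _)) (Z.acc_lt_pt q l) (Z.pt_lt_acc q l)
  have h4 := (Z.pt_strictMono p).lt_iff_lt.1 hc.1
  have h5 := (Z.pt_strictMono p).lt_iff_lt.1 hc.2
  omega

theorem acc_castSucc_notMem_preimage (p : Fin m) : Z.acc p.castSucc ∉ Z.preimage := by
  rintro ⟨q, l, n, h⟩
  have h1 := Z.acc_nonneg p.castSucc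
  have h2 : Z.acc p.castSucc < 2 * Real.pi :=
    (Z.acc_strictMono Fin.castSucc_lt_succ).trans_le (Z.acc_le_two_pi p.succ)
  have h3 := Z.pt_mem_Ioo q l
  obtain rfl : n = 0 := eq_zero_of_add_mem h3.1.le h3.2 (h ▸ h1) (h ▸ h2)
  simp only [Int.cast_zero, mul_zero, zero_mul, add_zero] at h
  have h4 := Z.acc_strictMono.lt_iff_lt.1 (h ▸ Z.acc_lt_pt q l : Z.acc q.castSucc < _)
  have h5 := Z.acc_strictMono.lt_iff_lt.1 (h ▸ Z.pt_lt_acc q l : _ < Z.acc q.succ)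
  simp only [Fin.lt_def, Fin.val_castSucc, Fin.val_succ] at h4 h5
  omega

theorem exists_mem_preimage_right (p : Fin m) {ε : ℝ} (hε : 0 < ε) :
    ∃ b ∈ Z.preimage, Z.acc p.castSucc < b ∧ b < Z.acc p.castSucc + ε := by
  obtain ⟨k, hk⟩ := ((Z.tendsto_atBot p).eventually_lt_const
    (show Z.acc p.castSucc < Z.acc p.castSucc + ε by linarith)).exists
  exact ⟨_, Z.pt_mem_preimage p k, Z.acc_lt_pt p k, hk⟩

/-- Every accumulation point is, modulo `2π`, the upper limit of one of the copies of `ℤ`. -/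
theorem exists_acc_succ_eq (p : Fin m) :
    ∃ (q : Fin m) (n : ℤ), Z.acc p.castSucc = Z.acc q.succ + 2 * n * Real.pi := by
  rcases Nat.eq_zero_or_pos p.val with h | h
  · refine ⟨⟨m - 1, by have := p.2; omega⟩, -1, ?_⟩
    have e1 : p.castSucc = 0 := Fin.ext h
    have e2 : Fin.succ (⟨m - 1, by have := p.2; omega⟩ : Fin m) = Fin.last m :=
      Fin.ext (by have := p.2; simp only [Fin.succ_mk, Fin.val_last]; omega)
    rw [e1, e2, Z.acc_zero, Z.acc_last]
    push_cast; ring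
  · refine ⟨⟨p.val - 1, by have := p.2; omega⟩, 0, ?_⟩
    have e : p.castSucc = Fin.succ ⟨p.val - 1, by have := p.2; omega⟩ :=
      Fin.ext (by simp only [Fin.val_castSucc, Fin.succ_mk]; omega)
    rw [← e]; simp

theorem exists_mem_preimage_left (p : Fin m) {ε : ℝ} (hε : 0 < ε) :
    ∃ a ∈ Z.preimage, Z.acc p.castSucc - ε < a ∧ a < Z.acc p.castSucc := by
  obtain ⟨q, n, h⟩ := Z.exists_acc_succ_eq p
  obtain ⟨k, hk⟩ := ((Z.tendsto_atTop q).eventually_const_lt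
    (show Z.acc q.succ - ε < Z.acc q.succ by linarith)).exists
  exact ⟨_, Z.preimage_add (Z.pt_mem_preimage q k) n, by linarith, by
    linarith [Z.pt_lt_acc q k]⟩

/-- The translates of a point of the ∞-gon keep a positive distance from an accumulation
point. -/
theorem exists_pos_forall_le_or_le {x : ℝ} (hx : x ∈ Z.preimage) (p : Fin m) :
    ∃ ε > 0, ∀ n : ℤ, x + 2 * n * Real.pi ≤ Z.acc p.castSucc - ε ∨
      Z.acc p.castSucc + ε ≤ x + 2 * n * Real.pi := by
  set A := Z.acc p.castSucc
  have hp := Real.pi_pos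
  -- The translate `r` of `x` in `[A, A + 2π)` is different from `A`.
  set j := ⌊(x - A) / (2 * Real.pi)⌋
  have h1 : (j : ℝ) ≤ (x - A) / (2 * Real.pi) := Int.floor_le _
  have h2 : (x - A) / (2 * Real.pi) < j + 1 := Int.lt_floor_add_one _
  rw [le_div_iff₀ Real.two_pi_pos] at h1
  rw [div_lt_iff₀ Real.two_pi_pos] at h2
  have h3 : x + 2 * (-j : ℤ) * Real.pi ≠ A := fun h =>
    Z.acc_castSucc_notMem_preimage p (h ▸ Z.preimage_add hx (-j) : A ∈ Z.preimage)
  push_cast at h3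
  have h4 : 0 < x - 2 * j * Real.pi - A :=
    lt_of_le_of_ne (by linarith) fun h => h3 (by linarith)
  refine ⟨min (x - 2 * j * Real.pi - A) (A + 2 * Real.pi - (x - 2 * j * Real.pi)),
    lt_min h4 (by linarith), fun n => ?_⟩
  have h5 := min_le_left (x - 2 * j * Real.pi - A) (A + 2 * Real.pi - (x - 2 * j * Real.pi))
  have h6 := min_le_right (x - 2 * j * Real.pi - A) (A + 2 * Real.pi - (x - 2 * j * Real.pi))
  rcases le_or_gt 0 (n + j) with h | h
  · right
    have h7 : (0 : ℝ) ≤ n + j := by exact_mod_cast h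
    nlinarith
  · left
    have h7 : (n : ℝ) + j ≤ -1 := by exact_mod_cast (by omega : n + j ≤ -1)
    nlinarith

/-- Every real number has a translate in `[0, 2π)`, which lies between two consecutive accumulation
points. -/
theorem exists_eq_add_of_real (x : ℝ) :
    ∃ (y : ℝ) (n : ℤ) (p : Fin m), x = y + 2 * n * Real.pi ∧ Z.acc p.castSucc ≤ y ∧
      y < Z.acc p.succ := by
  have h1 : (⌊x / (2 * Real.pi)⌋ : ℝ) ≤ x / (2 * Real.pi) := Int.floor_le _
  have h2 := Int.lt_floor_add_one (x / (2 * Real.pi))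
  rw [le_div_iff₀ Real.two_pi_pos] at h1
  rw [div_lt_iff₀ Real.two_pi_pos] at h2
  obtain ⟨p, hp⟩ := Z.exists_acc_le_lt (x := x - 2 * ⌊x / (2 * Real.pi)⌋ * Real.pi)
    (by linarith) (by linarith)
  exact ⟨_, ⌊x / (2 * Real.pi)⌋, p, by ring, hp⟩

/-- The value of the Kupisch function at a point of the ∞-gon. -/
theorem kupisch_pt_add (p : Fin m) (k n : ℤ) :
    Z.kupisch (Z.pt p k + 2 * n * Real.pi) = 2 * Real.pi + Z.pt p (k + 1) - Z.pt p k := by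
  have hs : toIcoMod Real.two_pi_pos 0 (Z.pt p k + 2 * n * Real.pi) = Z.pt p k := by
    rw [toIcoMod_eq_iff]
    have h := Z.pt_mem_Ioo p k
    exact ⟨⟨h.1.le, by simpa using h.2⟩, n, by rw [zsmul_eq_mul]; ring⟩
  have hex : ∃ q : Fin m × ℤ, Z.pt p k ∈ Set.Ico (Z.pt q.1 q.2) (Z.pt q.1 (q.2 + 1)) :=
    ⟨(p, k), le_rfl, Z.pt_strictMono p (by simp)⟩
  -- The point chosen in the definition of the Kupisch function is unique.
  have key : ∀ h : (∃ q : Fin m × ℤ, Z.pt p k ∈ Set.Ico (Z.pt q.1 q.2) (Z.pt q.1 (q.2 + 1))),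
      h.choose = (p, k) := by
    intro h
    obtain ⟨h1, h2⟩ := h.choose_spec
    obtain h3 := (Z.le_or_le_of_mem_preimage (Z.pt_mem_preimage p k) h.choose.1
      h.choose.2).resolve_right (not_le.2 h2)
    have h4 := le_antisymm h1 h3
    have h5 : h.choose.1 = p := Z.eq_of_mem_Ioo (Z.acc_lt_pt _ _) (Z.pt_lt_acc _ _)
      ((Z.acc_lt_pt p k).trans_eq h4.symm) (h4.trans_lt (Z.pt_lt_acc p k))
    refine Prod.ext h5 ?_
    rw [h5] at h4
    exact (Z.pt_strictMono p).injective h4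
  rw [kupisch]
  generalize toIcoMod Real.two_pi_pos 0 (Z.pt p k + 2 * n * Real.pi) = s at hs ⊢
  subst hs
  rw [dif_pos hex, key hex]

end InfinityGon

/-! ### Intervals on which a representation is constant -/

section Constant

variable {K : Type w} [Field K] {M N L : RepS1 K} {c d : ℝ}

/-- The representation `M` is constant along the image in the circle of `(c, d]`. The interval may
be any interval of `ℝ`, since the condition is invariant under translation by `2π`. -/
def IsConstantOn (M : RepS1 K) (c d : ℝ) : Prop :=
  ∀ (s t : ℝ) (_ : c < s) (hst : s ≤ t) (_ : t ≤ d), IsIso (M.map (pathOfLE hst))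

theorem isIso_map_of_length_eq {x y x' y' : S1} (f : S1.Path x y) (g : S1.Path x' y')
    (hx : x = x') (hy : y = y') (hfg : f.length = g.length)
    (hf : IsIso (M.map (X := x) (Y := y) f)) : IsIso (M.map (X := x') (Y := y') g) := by
  subst hx hy
  obtain rfl : f = g := S1.Path.ext hfg
  exact hf

theorem IsConstantOn.add (h : IsConstantOn M c d) (n : ℤ) :
    IsConstantOn M (c + 2 * n * Real.pi) (d + 2 * n * Real.pi) := by
  intro s t hs hst ht
  have e : ∀ r : ℝ, r - 2 * n * Real.pi = r + 2 * (-n : ℤ) * Real.pi := fun r => by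
    push_cast; ring
  have h1 : s - 2 * n * Real.pi ≤ t - 2 * n * Real.pi := by linarith
  refine isIso_map_of_length_eq _ _ ?_ ?_ ?_ (h _ _ (by linarith) h1 (by linarith))
  · rw [e, cov_add_two_mul_int_mul_pi]
  · rw [e, cov_add_two_mul_int_mul_pi]
  · change t - 2 * n * Real.pi - (s - 2 * n * Real.pi) = t - s
    ring

theorem IsConstantOn.mono (h : IsConstantOn M c d) {c' d' : ℝ} (hc : c ≤ c') (hd : d' ≤ d) :
    IsConstantOn M c' d' := fun s t hs hst ht =>
  h s t (hc.trans_lt hs) hst (ht.trans hd)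

theorem IsConstantOn.of_isDirectSummand (h : IsConstantOn M c d) (hN : IsDirectSummand N M) :
    IsConstantOn N c d := fun s t hs hst ht => by
  obtain ⟨i, p, hip⟩ := hN.exists_retract
  have := h s t hs hst ht
  exact isIso_map_of_retract hip _

theorem IsDirectSum.isConstantOn (h : IsDirectSum M N L) (hN : IsConstantOn N c d)
    (hL : IsConstantOn L c d) : IsConstantOn M c d := fun s t hs hst ht => by
  have := hN s t hs hst ht
  have := hL s t hs hst ht
  exact h.isIso_map _

theorem IsConstantOn.mem_iff {U : BoundedInterval} (h : IsConstantOn (stringRep K U) c d)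
    {s t : ℝ} (hs : c < s) (hst : s ≤ t) (ht : t ≤ d) : s ∈ U.carrier ↔ t ∈ U.carrier := by
  have h1 := (isIso_stringRep_map_iff (K := K) (U := U) (pathOfLE hst)).1 (h s t hs hst ht) s rfl
  have h2 : s + S1.Path.length (pathOfLE hst) = t := add_sub_cancel s t
  rwa [h2] at h1

/-- The string of `(a, b]` is constant on `(c, d]` if no translate of `a` or `b` lies strictly
between `c` and `d`. -/
theorem isConstantOn_stringRep_Ioc {a b : ℝ}
    (ha : ∀ n : ℤ, a + 2 * n * Real.pi ≤ c ∨ d ≤ a + 2 * n * Real.pi)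
    (hb : ∀ n : ℤ, b + 2 * n * Real.pi ≤ c ∨ d ≤ b + 2 * n * Real.pi) :
    IsConstantOn (stringRep K (BoundedInterval.Ioc a b)) c d := by
  intro s t hs hst ht
  refine (isIso_stringRep_map_iff (K := K) _).2 fun r hr => ?_
  obtain ⟨n, rfl⟩ := cov_eq_cov_iff.1 hr
  have h2 : s + 2 * n * Real.pi + S1.Path.length (pathOfLE hst) = t + 2 * n * Real.pi := by
    change s + 2 * n * Real.pi + (t - s) = _
    ring
  rw [h2]
  have key : ∀ e : ℝ, (∀ n : ℤ, e + 2 * n * Real.pi ≤ c ∨ d ≤ e + 2 * n * Real.pi) →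
      (e < s + 2 * n * Real.pi ↔ e < t + 2 * n * Real.pi) := by
    intro e he
    have h3 := he (-n)
    push_cast at h3
    constructor
    · intro h; linarith
    · intro h
      rcases h3 with h3 | h3 <;> linarith
  exact and_congr (key a ha) (not_lt.symm.trans ((not_congr (key b hb)).trans not_lt))

end Constant

theorem BoundedInterval.eq_of_carrier_eq {U V : BoundedInterval} (h : U.carrier = V.carrier) :
    U = V := by
  cases U
  cases V
  cases h
  rfl

namespace InfinityGon

variable {Z : InfinityGon m} {K : Type w} [Field K] {M N L : RepS1 K}

theorem isConstantBetween_iff : Z.IsConstantBetween M ↔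
    ∀ p k, IsConstantOn M (Z.pt p k) (Z.pt p (k + 1)) := Iff.rfl

theorem isConstantNear_iff : Z.IsConstantNear M ↔
    ∀ p : Fin m, ∃ a ∈ Z.preimage, ∃ b ∈ Z.preimage,
    a < Z.acc p.castSucc ∧ Z.acc p.castSucc < b ∧ b < a + 2 * Real.pi ∧
      IsConstantOn M a b := Iff.rfl

/-- Being constant near the accumulation points only has to be checked on some neighbourhoods
of these, since the ∞-gon has points in every neighbourhood on both sides. -/
theorem isConstantNear_of_exists_pos
    (h : ∀ p : Fin m, ∃ ε > 0, IsConstantOn M (Z.acc p.castSucc - ε) (Z.acc p.castSucc + ε)) :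
    Z.IsConstantNear M := by
  refine isConstantNear_iff.2 fun p => ?_
  obtain ⟨ε, hε, hM⟩ := h p
  have hp := Real.pi_pos
  obtain ⟨a, ha, ha1, ha2⟩ := Z.exists_mem_preimage_left p (lt_min hε hp)
  obtain ⟨b, hb, hb1, hb2⟩ := Z.exists_mem_preimage_right p (lt_min hε hp)
  have h1 := min_le_left ε Real.pi
  have h2 := min_le_right ε Real.pi
  exact ⟨a, ha, b, hb, ha2, hb1, by linarith, hM.mono (by linarith) (by linarith)⟩

theorem IsConstantNear.exists_pos (h : Z.IsConstantNear M) (p : Fin m) :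
    ∃ ε > 0, IsConstantOn M (Z.acc p.castSucc - ε) (Z.acc p.castSucc + ε) := by
  obtain ⟨a, -, b, -, ha, hb, -, hM⟩ := h p
  refine ⟨min (Z.acc p.castSucc - a) (b - Z.acc p.castSucc),
    lt_min (by linarith) (by linarith), IsConstantOn.mono hM ?_ ?_⟩
  · have := min_le_left (Z.acc p.castSucc - a) (b - Z.acc p.castSucc)
    linarith
  · have := min_le_right (Z.acc p.castSucc - a) (b - Z.acc p.castSucc)
    linarith

theorem IsConstantBetween.of_isDirectSummand (h : Z.IsConstantBetween M)
    (hN : IsDirectSummand N M) : Z.IsConstantBetween N := fun p k =>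
  (isConstantBetween_iff.1 h p k).of_isDirectSummand hN

theorem IsConstantNear.of_isDirectSummand (h : Z.IsConstantNear M)
    (hN : IsDirectSummand N M) : Z.IsConstantNear N :=
  isConstantNear_of_exists_pos fun p =>
    let ⟨ε, hε, hM⟩ := h.exists_pos p
    ⟨ε, hε, hM.of_isDirectSummand hN⟩

theorem isConstantBetween_of_isDirectSum (h : IsDirectSum M N L) (hN : Z.IsConstantBetween N)
    (hL : Z.IsConstantBetween L) : Z.IsConstantBetween M := fun p k =>
  h.isConstantOn (isConstantBetween_iff.1 hN p k) (isConstantBetween_iff.1 hL p k)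

theorem isConstantNear_of_isDirectSum (h : IsDirectSum M N L) (hN : Z.IsConstantNear N)
    (hL : Z.IsConstantNear L) : Z.IsConstantNear M := by
  refine isConstantNear_of_exists_pos fun p => ?_
  obtain ⟨ε, hε, h1⟩ := hN.exists_pos p
  obtain ⟨δ, hδ, h2⟩ := hL.exists_pos p
  have h3 := min_le_left ε δ
  have h4 := min_le_right ε δ
  exact ⟨min ε δ, lt_min hε hδ, h.isConstantOn (h1.mono (by linarith) (by linarith))
    (h2.mono (by linarith) (by linarith))⟩

theorem isConstantBetween_stringRep_Ioc {a b : ℝ} (ha : a ∈ Z.preimage) (hb : b ∈ Z.preimage) :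
    Z.IsConstantBetween (stringRep K (BoundedInterval.Ioc a b)) := fun p k =>
  isConstantOn_stringRep_Ioc
    (fun n => Z.le_or_le_of_mem_preimage (Z.preimage_add ha n) p k)
    (fun n => Z.le_or_le_of_mem_preimage (Z.preimage_add hb n) p k)

theorem isConstantNear_stringRep_Ioc {a b : ℝ} (ha : a ∈ Z.preimage) (hb : b ∈ Z.preimage) :
    Z.IsConstantNear (stringRep K (BoundedInterval.Ioc a b)) := by
  refine isConstantNear_of_exists_pos fun p => ?_
  obtain ⟨ε, hε, h1⟩ := Z.exists_pos_forall_le_or_le ha p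
  obtain ⟨δ, hδ, h2⟩ := Z.exists_pos_forall_le_or_le hb p
  have h3 := min_le_left ε δ
  have h4 := min_le_right ε δ
  refine ⟨min ε δ, lt_min hε hδ, isConstantOn_stringRep_Ioc (fun n => ?_) fun n => ?_⟩
  · exact (h1 n).imp (fun h => by linarith) fun h => by linarith
  · exact (h2 n).imp (fun h => by linarith) fun h => by linarith

/-- Every real number lies in an interval `(c, d]` of constancy, and it is the upper end point of
this interval only if it is a point of the ∞-gon. -/
theorem exists_isConstantOn_left (h1 : Z.IsConstantBetween M) (h2 : Z.IsConstantNear M) (x : ℝ) :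
    ∃ c d, c < x ∧ x ≤ d ∧ (x < d ∨ x ∈ Z.preimage) ∧ IsConstantOn M c d := by
  obtain ⟨y, n, p, rfl, hy1, hy2⟩ := Z.exists_eq_add_of_real x
  rcases hy1.eq_or_lt with rfl | hy1
  · obtain ⟨ε, hε, hM⟩ := h2.exists_pos p
    exact ⟨_, _, by linarith, by linarith, Or.inl (by linarith), hM.add n⟩
  · obtain ⟨k, hk1, hk2⟩ := Z.exists_pt_lt_le hy1 hy2
    refine ⟨_, _, by linarith, by linarith, ?_, (isConstantBetween_iff.1 h1 p k).add n⟩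
    rcases hk2.eq_or_lt with rfl | hk2
    · exact Or.inr (Z.preimage_add (Z.pt_mem_preimage _ _) n)
    · exact Or.inl (by linarith)

/-- Representations are constant immediately to the right of every real number. -/
theorem exists_isConstantOn_right (h1 : Z.IsConstantBetween M) (h2 : Z.IsConstantNear M)
    (x : ℝ) : ∃ c d, c ≤ x ∧ x < d ∧ IsConstantOn M c d := by
  obtain ⟨y, n, p, rfl, hy1, hy2⟩ := Z.exists_eq_add_of_real x
  rcases hy1.eq_or_lt with rfl | hy1
  · obtain ⟨ε, hε, hM⟩ := h2.exists_pos p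
    exact ⟨_, _, by linarith, by linarith, hM.add n⟩
  · obtain ⟨k, hk1, hk2⟩ := Z.exists_pt_lt_le hy1 hy2
    rcases hk2.eq_or_lt with rfl | hk2
    · have := Z.pt_strictMono p (show k + 1 < k + 1 + 1 by omega)
      exact ⟨_, _, le_rfl, by linarith, (isConstantBetween_iff.1 h1 p (k + 1)).add n⟩
    · exact ⟨_, _, by linarith, by linarith, (isConstantBetween_iff.1 h1 p k).add n⟩

/-- By compactness of the circle, finitely many intervals on which the representation is
constant cover the circle; their upper end points sample the representation. -/
theorem exists_isSampledBy (h1 : Z.IsConstantBetween M) (h2 : Z.IsConstantNear M) :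
    ∃ T : Finset S1, IsSampledBy T M := by
  classical
  have key : ∃ T : Finset S1, ∀ x ∈ Set.Icc 0 (2 * Real.pi),
      ∃ t ∈ T, ∃ f : cov x ⟶ t, IsIso (M.map f) := by
    refine isCompact_Icc.induction_on (p := fun S : Set ℝ => ∃ T : Finset S1, ∀ x ∈ S,
      ∃ t ∈ T, ∃ f : cov x ⟶ t, IsIso (M.map f)) ⟨∅, by simp⟩ ?_ ?_ ?_
    · rintro S S' hS ⟨T, hT⟩
      exact ⟨T, fun x hx => hT x (hS hx)⟩
    · rintro S S' ⟨T, hT⟩ ⟨T', hT'⟩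
      refine ⟨T ∪ T', ?_⟩
      rintro x (hx | hx)
      · obtain ⟨t, ht, h⟩ := hT x hx
        exact ⟨t, Finset.mem_union_left _ ht, h⟩
      · obtain ⟨t, ht, h⟩ := hT' x hx
        exact ⟨t, Finset.mem_union_right _ ht, h⟩
    · intro x _
      obtain ⟨c, d, hcx, hxd, -, hM⟩ := exists_isConstantOn_left h1 h2 x
      obtain ⟨c', d', hcx', hxd', hM'⟩ := exists_isConstantOn_right h1 h2 x
      refine ⟨Set.Ioo c d', mem_nhdsWithin_of_mem_nhds (Ioo_mem_nhds hcx hxd'),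
        {cov d, cov d'}, fun y hy => ?_⟩
      rcases le_or_gt y x with h | h
      · exact ⟨cov d, by simp, pathOfLE (h.trans hxd), hM y d hy.1 _ le_rfl⟩
      · exact ⟨cov d', by simp, pathOfLE hy.2.le, hM' y d' (hcx'.trans_lt h) _ le_rfl⟩
  obtain ⟨T, hT⟩ := key
  refine ⟨T, fun x => ?_⟩
  obtain ⟨s, rfl⟩ := cov_surjective x
  obtain ⟨y, n, p, rfl, hy1, hy2⟩ := Z.exists_eq_add_of_real s
  rw [cov_add_two_mul_int_mul_pi]
  exact hT y ⟨(Z.acc_nonneg _).trans hy1, hy2.le.trans (Z.acc_le_two_pi _)⟩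

/-- If the string of a nonempty interval is constant between consecutive points and near
the accumulation points, then the interval is of the form `(a, b]` with end points over the ∞-gon:
membership in the interval is constant on the intervals `(c, d]` along which the string is, so
it can change only at a point of the ∞-gon and only after that point. -/
theorem exists_eq_Ioc {U : BoundedInterval} (hU : U.carrier.Nonempty)
    (h1 : Z.IsConstantBetween (stringRep K U)) (h2 : Z.IsConstantNear (stringRep K U)) :
    ∃ a ∈ Z.preimage, ∃ b ∈ Z.preimage, a < b ∧ U = BoundedInterval.Ioc a b := by
  have hlow : ∀ x ∈ U.carrier, sInf U.carrier ≤ x := fun x hx => csInf_le U.bddBelow hx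
  have hupp : ∀ x ∈ U.carrier, x ≤ sSup U.carrier := fun x hx => le_csSup U.bddAbove hx
  obtain ⟨ha, haU⟩ : sInf U.carrier ∈ Z.preimage ∧ sInf U.carrier ∉ U.carrier := by
    obtain ⟨c, d, hc, hd, hd', hM⟩ := exists_isConstantOn_left h1 h2 (sInf U.carrier)
    obtain ⟨e, hce, hea⟩ := exists_between hc
    have he : e ∉ U.carrier := fun h => (hlow e h).not_gt hea
    refine ⟨hd'.resolve_left fun hlt => ?_, fun h => he ((hM.mem_iff hce hea.le hd).2 h)⟩
    obtain ⟨x, hx, hxd⟩ := exists_lt_of_csInf_lt hU hlt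
    exact he ((hM.mem_iff hce (hea.le.trans (hlow x hx)) hxd.le).2 hx)
  obtain ⟨hb, hbU⟩ : sSup U.carrier ∈ Z.preimage ∧ sSup U.carrier ∈ U.carrier := by
    obtain ⟨c, d, hc, hd, hd', hM⟩ := exists_isConstantOn_left h1 h2 (sSup U.carrier)
    obtain ⟨x, hx, hcx⟩ := exists_lt_of_lt_csSup hU hc
    refine ⟨hd'.resolve_left fun hlt => ?_, (hM.mem_iff hcx (hupp x hx) hd).1 hx⟩
    exact (hupp d ((hM.mem_iff hcx ((hupp x hx).trans hd) le_rfl).1 hx)).not_gt hlt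
  have hlt : sInf U.carrier < sSup U.carrier :=
    lt_of_le_of_ne (hlow _ hbU) fun h => haU (h ▸ hbU)
  refine ⟨_, ha, _, hb, hlt, ?_⟩
  have hcar : U.carrier = Set.Ioc (sInf U.carrier) (sSup U.carrier) := by
    ext x
    constructor
    · exact fun hx => ⟨lt_of_le_of_ne (hlow x hx) fun h => haU (h ▸ hx), hupp x hx⟩
    · rintro ⟨hx1, hx2⟩
      obtain ⟨y, hy, hyx⟩ := exists_lt_of_csInf_lt hU hx1
      exact U.ordConnected.out hy hbU ⟨hyx.le, hx2⟩
  exact BoundedInterval.eq_of_carrier_eq hcar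

/-! ### The strings of the category -/

theorem exists_of_mem_intervals {U : BoundedInterval} (hU : U ∈ Z.intervals) :
    ∃ (p : Fin m) (k : ℤ), ∃ b ∈ Z.preimage, U = BoundedInterval.Ioc (Z.pt p k) b ∧
      Z.pt p k < b ∧ b ≤ Z.pt p (k + 1) + 2 * Real.pi := by
  obtain ⟨p, q, k, l, h, rfl, h1, h2⟩ := hU
  exact ⟨p, k, _, ⟨q, l, h, rfl⟩, rfl, (Z.pt_strictMono p (by omega)).trans_le h1, h2⟩

theorem isLocalRing_end_stringRep {U : BoundedInterval} (hU : U ∈ Z.intervals) :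
    IsLocalRing (End (stringRep K U)) := by
  obtain ⟨p, k, b, -, rfl, h, -⟩ := exists_of_mem_intervals hU
  exact isLocalRing_end_stringRep_Ioc h

theorem isIndecomposable_stringRep {U : BoundedInterval} (hU : U ∈ Z.intervals) :
    IsIndecomposable (stringRep K U) :=
  have := isLocalRing_end_stringRep (K := K) hU
  isIndecomposable_of_isLocalRing

theorem subset_Icc_kupisch {U : BoundedInterval} (hU : U ∈ Z.intervals) : U.carrier ⊆
    Set.Icc (sInf U.carrier) (sInf U.carrier + Z.kupisch (sInf U.carrier)) := by
  obtain ⟨p, k, b, -, rfl, h, h'⟩ := exists_of_mem_intervals hU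
  have hinf : sInf (BoundedInterval.Ioc (Z.pt p k) b).carrier = Z.pt p k := csInf_Ioc h
  have hk := Z.kupisch_pt_add p k 0
  simp only [Int.cast_zero, mul_zero, zero_mul, add_zero] at hk
  rw [hinf, hk]
  rintro x ⟨hx1, hx2⟩
  exact ⟨hx1.le, by linarith⟩

theorem isNakayama_stringRep {U : BoundedInterval} (hU : U ∈ Z.intervals) :
    Z.isNakayama K (stringRep K U) := by
  refine ⟨⟨fun x => inferInstance, fun N hN hNU => ⟨U, subset_Icc_kupisch hU, ?_⟩⟩, ?_⟩
  · obtain ⟨i, p, hip⟩ := hNU.exists_retract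
    exact (isIndecomposable_stringRep hU).nonempty_iso_of_retract hN.1 hip
  · obtain ⟨p, k, b, hb, rfl, -, -⟩ := exists_of_mem_intervals hU
    exact ⟨isConstantBetween_stringRep_Ioc (Z.pt_mem_preimage p k) hb,
      isConstantNear_stringRep_Ioc (Z.pt_mem_preimage p k) hb⟩

/-- An indecomposable representation in the category is a string by assumption; the interval is
of the form `(a, b]` by constancy, the Kupisch function bounds its length, and a
translation moves `a` into `(0, 2π)`. -/
theorem exists_mem_intervals_iso (hM : Z.isNakayama K M) (hind : IsIndecomposable N)
    (hN : IsDirectSummand N M) : ∃ U ∈ Z.intervals, Nonempty (N ≅ stringRep K U) := by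
  obtain ⟨U, hU, ⟨e⟩⟩ := hM.1.2 N hind hN
  have hne : U.carrier.Nonempty := by
    rw [Set.nonempty_iff_ne_empty]
    exact fun h => hind.1 ((stringRep_isZero_iff.2 h).of_iso e)
  have hUM : IsDirectSummand (stringRep K U) M :=
    (isDirectSummand_of_retract e.inv_hom_id).trans hN
  obtain ⟨a, ⟨p, k, n, rfl⟩, b, ⟨q, l, j, rfl⟩, hab, rfl⟩ := exists_eq_Ioc hne
    (hM.2.1.of_isDirectSummand hUM) (hM.2.2.of_isDirectSummand hUM)
  set a := Z.pt p k + 2 * n * Real.pi with ha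
  set b := Z.pt q l + 2 * j * Real.pi with hb
  have hinf : sInf (BoundedInterval.Ioc a b).carrier = a := csInf_Ioc hab
  have hbmem : b ≤ a + Z.kupisch a := hinf ▸ (hU (show b ∈ _ from ⟨hab, le_rfl⟩)).2
  rw [ha, Z.kupisch_pt_add] at hbmem
  have e1 : Z.pt q l + 2 * (j - n : ℤ) * Real.pi = b - 2 * n * Real.pi := by
    rw [hb]; push_cast; ring
  refine ⟨BoundedInterval.Ioc (Z.pt p k) (Z.pt q l + 2 * (j - n : ℤ) * Real.pi),
    ⟨p, q, k, l, j - n, rfl, ?_, by rw [e1]; linarith⟩, ?_⟩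
  · have hmem : Z.pt q l + 2 * (j - n : ℤ) * Real.pi ∈ Z.preimage :=
      Z.preimage_add (Z.pt_mem_preimage q l) _
    refine (Z.le_or_le_of_mem_preimage hmem p k).resolve_left (not_le.2 ?_)
    rw [e1]; linarith
  · obtain ⟨e'⟩ := nonempty_stringRep_iso (K := K) (U := BoundedInterval.Ioc a b)
      (V := BoundedInterval.Ioc (Z.pt p k) (Z.pt q l + 2 * (j - n : ℤ) * Real.pi)) (-n) fun r => by
        rw [e1]
        change a < r ∧ r ≤ b ↔ Z.pt p k < r + 2 * (-n : ℤ) * Real.pi ∧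
          r + 2 * (-n : ℤ) * Real.pi ≤ b - 2 * n * Real.pi
        push_cast
        constructor <;> rintro ⟨h1, h2⟩ <;> constructor <;> linarith
    exact ⟨e ≪≫ e'⟩

/-! ### The category of representations -/

/-- The category is closed under direct summands in the category of all representations. -/
theorem isNakayama_of_isDirectSummand (hM : Z.isNakayama K M) (hN : IsDirectSummand N M) :
    Z.isNakayama K N :=
  ⟨⟨fun x => have := hM.1.1 x; finiteDimensional_of_isDirectSummand hN x,
    fun L hL hLN => hM.1.2 L hL (hLN.trans hN)⟩,
    hM.2.1.of_isDirectSummand hN, hM.2.2.of_isDirectSummand hN⟩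

/-- Every object of the category is a finite direct sum of strings of intervals in
`Z.intervals`. -/
theorem exists_isDecomposition (hM : Z.isNakayama K M) :
    ∃ (ι : Type) (_ : Fintype ι) (U : ι → BoundedInterval), (∀ i, U i ∈ Z.intervals) ∧
      IsDecomposition M fun i => stringRep K (U i) := by
  obtain ⟨T, hT⟩ := exists_isSampledBy hM.2.1 hM.2.2
  obtain ⟨ι, _, f, hf, hind⟩ := hT.exists_isDecomposition hM.1.1
  choose U hU e using fun i => exists_mem_intervals_iso hM (hind i) (hf.isDirectSummand i)
  exact ⟨ι, inferInstance, U, hU, hf.congr fun i => (e i).some⟩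

/-- Uniqueness of decompositions into strings. The representation `M` is only assumed to be constant
and pointwise finite, so that this applies to direct sums before these are known to be continuous
Nakayama representations. -/
theorem exists_iso_of_isDecomposition {ι : Type} [Fintype ι] {U : ι → BoundedInterval}
    (hU : ∀ i, U i ∈ Z.intervals) (hdec : IsDecomposition M fun i => stringRep K (U i))
    (h0 : IsPointwiseFinite M) (h1 : Z.IsConstantBetween M) (h2 : Z.IsConstantNear M)
    (hind : IsIndecomposable N) (hN : IsDirectSummand N M) :
    ∃ i, Nonempty (N ≅ stringRep K (U i)) := by
  obtain ⟨T, hT⟩ := exists_isSampledBy h1 h2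
  have := (hT.of_isDirectSummand hN).isLocalRing_end
    (fun x => have := h0 x; finiteDimensional_of_isDirectSummand hN x) hind
  exact hdec.exists_iso_of_retract (fun i => isIndecomposable_stringRep (hU i)) hN

/-- The category is closed under direct sums: by the Krull–Schmidt theorem the indecomposable
summands of a direct sum are those of its summands. -/
theorem isNakayama_of_isDirectSum (h : IsDirectSum M N L) (hN : Z.isNakayama K N)
    (hL : Z.isNakayama K L) : Z.isNakayama K M := by
  have h0 : IsPointwiseFinite M := fun x =>
    have := hN.1.1 x
    have := hL.1.1 x
    h.finiteDimensional x
  have h1 := isConstantBetween_of_isDirectSum h hN.2.1 hL.2.1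
  have h2 := isConstantNear_of_isDirectSum h hN.2.2 hL.2.2
  refine ⟨⟨h0, fun Y hY hYM => ?_⟩, h1, h2⟩
  obtain ⟨ι, _, U, hU, hdN⟩ := exists_isDecomposition hN
  obtain ⟨κ, _, V, hV, hdL⟩ := exists_isDecomposition hL
  have hUV : ∀ i, Sum.elim U V i ∈ Z.intervals := by rintro (i | i); exacts [hU i, hV i]
  have hd : IsDecomposition M fun i => stringRep K (Sum.elim U V i) := by
    convert h.isDecomposition hdN hdL using 1
    ext1 (i | i) <;> rfl
  obtain ⟨i, hi⟩ := exists_iso_of_isDecomposition hUV hd h0 h1 h2 hY hYM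
  exact ⟨_, subset_Icc_kupisch (hUV i), hi⟩

theorem isNakayama_of_isZero (h : IsZero M) : Z.isNakayama K M := by
  have hM : ∀ x, Subsingleton (M.obj x) := isZero_iff_subsingleton.1 h
  have hiso : ∀ c d, IsConstantOn M c d := fun c d s t _ hst _ => by
    rw [ConcreteCategory.isIso_iff_bijective]
    have := hM (cov s)
    have := hM (cov t)
    exact ⟨Function.injective_of_subsingleton _, fun y => ⟨0, Subsingleton.elim _ _⟩⟩
  refine ⟨⟨fun x => have := hM x; inferInstance, fun N hN hNM => ?_⟩,
    fun p k => hiso _ _, isConstantNear_of_exists_pos fun p => ⟨1, one_pos, hiso _ _⟩⟩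
  obtain ⟨i, p, hip⟩ := hNM.exists_retract
  exact absurd ((IsZero.iff_id_eq_zero N).2 (by rw [← hip, h.eq_of_tgt i 0, zero_comp])) hN.1

/-- A direct sum in the full subcategory is the same as a direct sum of representations. -/
theorem isDirectSum_obj_iff {X A B : Z.Rep K} :
    IsDirectSum X.obj A.obj B.obj ↔ IsDirectSum X A B := by
  rw [isDirectSum_iff, isDirectSum_iff]
  constructor
  · rintro ⟨i, p, j, q, h1, h2, h3⟩
    refine ⟨ObjectProperty.homMk i, ObjectProperty.homMk p, ObjectProperty.homMk j,
      ObjectProperty.homMk q, ?_, ?_, ?_⟩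
    · exact ObjectProperty.hom_ext _ h1
    · exact ObjectProperty.hom_ext _ h2
    · exact ObjectProperty.hom_ext _ h3
  · rintro ⟨i, p, j, q, h1, h2, h3⟩
    exact ⟨i.hom, p.hom, j.hom, q.hom, congrArg (·.hom) h1, congrArg (·.hom) h2,
      congrArg (·.hom) h3⟩

theorem isZero_obj_iff {X : Z.Rep K} : IsZero X.obj ↔ IsZero X := by
  rw [IsZero.iff_id_eq_zero, IsZero.iff_id_eq_zero]
  exact ⟨fun h => ObjectProperty.hom_ext _ h, fun h => congrArg (·.hom) h⟩

theorem isDirectSummand_obj {X Y : Z.Rep K} (h : IsDirectSummand Y X) :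
    IsDirectSummand Y.obj X.obj := by
  obtain ⟨W, h⟩ := h
  exact ⟨W.obj, isDirectSum_obj_iff.2 h⟩

/-- Indecomposability in the full subcategory is indecomposability as a representation, since the
category is closed under direct summands. -/
theorem isIndecomposable_obj_iff {X : Z.Rep K} :
    IsIndecomposable X.obj ↔ IsIndecomposable X := by
  refine and_congr (not_congr isZero_obj_iff) ⟨fun h A B hAB => ?_, fun h A B hAB => ?_⟩
  · exact (h _ _ (isDirectSum_obj_iff.2 hAB)).imp isZero_obj_iff.1 isZero_obj_iff.1
  · let A' : Z.Rep K := ⟨A, isNakayama_of_isDirectSummand X.property hAB.isDirectSummand⟩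
    let B' : Z.Rep K := ⟨B, isNakayama_of_isDirectSummand X.property hAB.symm.isDirectSummand⟩
    exact (h A' B' (isDirectSum_obj_iff.1 hAB)).imp isZero_obj_iff.2 isZero_obj_iff.2

theorem hasFiniteBiproducts : HasFiniteBiproducts (Z.Rep K) := by
  have : HasZeroObject (Z.Rep K) := by
    obtain ⟨M, hM⟩ := HasZeroObject.zero (C := RepS1 K)
    exact ⟨⟨⟨M, isNakayama_of_isZero hM⟩, isZero_obj_iff.1 hM⟩⟩
  have : HasBinaryBiproducts (Z.Rep K) := by
    refine ⟨fun A B => ?_⟩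
    have h : IsDirectSum (A.obj ⊞ B.obj) A.obj B.obj :=
      ⟨BinaryBiproduct.bicone _ _, ⟨BinaryBiproduct.isBilimit _ _⟩, ⟨Iso.refl _⟩⟩
    let X : Z.Rep K := ⟨A.obj ⊞ B.obj, isNakayama_of_isDirectSum h A.property B.property⟩
    obtain ⟨b, ⟨hb⟩, -⟩ : IsDirectSum X A B := isDirectSum_obj_iff.1 h
    exact ⟨⟨⟨b, hb⟩⟩⟩
  have := hasFiniteProducts_of_has_binary_and_terminal (C := Z.Rep K)
  exact HasFiniteBiproducts.of_hasFiniteProducts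

theorem isLocalRing_end_mk {U : BoundedInterval} (hU : U ∈ Z.intervals) :
    IsLocalRing (End (⟨stringRep K U, isNakayama_stringRep hU⟩ : Z.Rep K)) := by
  have := isLocalRing_end_stringRep (K := K) hU
  have : Nontrivial (End (⟨stringRep K U, isNakayama_stringRep hU⟩ : Z.Rep K)) :=
    nontrivial_end fun h => (isIndecomposable_stringRep hU).1 (isZero_obj_iff.2 h)
  refine ⟨fun {a b} hab => ?_⟩
  have h := IsLocalRing.isUnit_or_isUnit_of_add_one (R := End (stringRep K U)) (a := a.hom)
    (b := b.hom) (congrArg (·.hom) hab)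
  refine h.imp ?_ ?_ <;>
  · intro h
    rw [isUnit_iff_isIso] at h ⊢
    exact (isIso_iff_of_reflects_iso _ (ObjectProperty.ι _)).1 h

theorem isKrullSchmidt_rep : IsKrullSchmidt (Z.Rep K) where
  toHasFiniteBiproducts := hasFiniteBiproducts
  exists_decomposition X := by
    have := hasFiniteBiproducts (Z := Z) (K := K)
    obtain ⟨ι, _, U, hU, h⟩ := exists_isDecomposition X.property
    obtain ⟨j, p, h1, h2, h3⟩ := h.reindex (Fintype.equivFin ι).symm
    refine ⟨Fintype.card ι, fun i => ⟨stringRep K (U ((Fintype.equivFin ι).symm i)),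
      isNakayama_stringRep (hU _)⟩, fun i => isLocalRing_end_mk (hU _),
      IsDecomposition.nonempty_iso_biproduct ⟨fun i => ObjectProperty.homMk (j i),
        fun i => ObjectProperty.homMk (p i), fun i => ?_, fun i k hik => ?_, ?_⟩⟩
    · exact ObjectProperty.hom_ext _ (h1 i)
    · exact ObjectProperty.hom_ext _ (h2 i k hik)
    · refine (ObjectProperty.ι _).map_injective ?_
      rw [Functor.map_sum]
      exact h3

end InfinityGon

end InfiniteNakayama

end

theorem mainTheorem3 {K : Type*} [Field K] {m : ℕ} (hm : 0 < m)
    (Z : InfiniteNakayama.InfinityGon m) :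
    InfiniteNakayama.IsKrullSchmidt (Z.Rep K) ∧
    (∀ X : Z.Rep K, ∃ S : Set InfiniteNakayama.BoundedInterval, S.Finite ∧ S ⊆ Z.intervals ∧
      ∀ Y : Z.Rep K, InfiniteNakayama.IsIndecomposable Y →
        InfiniteNakayama.IsDirectSummand Y X →
        ∃ U ∈ S, Nonempty (Y.obj ≅ InfiniteNakayama.stringRep K U)) ∧
    (∀ U ∈ Z.intervals, Z.isNakayama K (InfiniteNakayama.stringRep K U)) ∧
    (∀ X : Z.Rep K, InfiniteNakayama.IsIndecomposable X ↔
      ∃ U ∈ Z.intervals, Nonempty (X.obj ≅ InfiniteNakayama.stringRep K U)) := by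
  refine ⟨InfiniteNakayama.InfinityGon.isKrullSchmidt_rep, fun X => ?_,
    fun U hU => InfiniteNakayama.InfinityGon.isNakayama_stringRep hU, fun X => ⟨fun h => ?_, ?_⟩⟩
  · obtain ⟨ι, _, U, hU, hdec⟩ := InfiniteNakayama.InfinityGon.exists_isDecomposition X.property
    refine ⟨Set.range U, Set.finite_range U, Set.range_subset_iff.2 hU, fun Y hY hYX => ?_⟩
    obtain ⟨i, hi⟩ := InfiniteNakayama.InfinityGon.exists_iso_of_isDecomposition hU hdec
      X.property.1.1 X.property.2.1 X.property.2.2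
      (InfiniteNakayama.InfinityGon.isIndecomposable_obj_iff.2 hY)
      (InfiniteNakayama.InfinityGon.isDirectSummand_obj hYX)
    exact ⟨U i, Set.mem_range_self i, hi⟩
  · exact InfiniteNakayama.InfinityGon.exists_mem_intervals_iso X.property
      (InfiniteNakayama.InfinityGon.isIndecomposable_obj_iff.2 h)
      (InfiniteNakayama.isDirectSummand_of_retract (Category.id_comp (𝟙 _)))
  · rintro ⟨U, hU, ⟨e⟩⟩
    exact InfiniteNakayama.InfinityGon.isIndecomposable_obj_iff.1
      ((InfiniteNakayama.InfinityGon.isIndecomposable_stringRep hU).of_iso e.symm)
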